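/- **Theorem (ROLL).** Consider $n$ processes that communicate by messages, fail by crashing, and use a realistic failure detector in an environment containing all failure patterns with at most $f$ failures, where $0\le f<n$. Let $\mathcal C$ be a set of commands with a symmetric, irreflexive conflict relation, let each command $c$ have a coordinator $\mathrm{coord}(c)$, and suppose that some two conflicting commands have different coordinators. Each process $p$ runs an automaton whose local state determines its next instruction: attempt to receive a message (possibly obtaining none although one is in transit), query the failure detector, change the local state (possibly depending on a free choice, e.g. of a quorum), send one message, or return a pair $(D,\mathit{flag})$, with $D\in 2^{\mathcal C}\cup\{\top\}$, from the announcement of a command. In addition the coordinator of $c$ may at any time, at most once, submit $c$; this invokes $\mathrm{announce}(c)$. Each process stores for every command $c$ a value $\mathrm{deps}(c)\in\{\bot,\top\}\cup 2^{\mathcal C}$; $c$ is pending if it is $\bot$, aborted if it is $\top$, committed if it is a set, decided if it is not $\bot$, and stable if $c$ is committed and no command in the transitive closure of $\mathrm{deps}$ starting from $c$ is pending. In an infinite run, every correct process takes infinitely many steps of its automaton and, if it attempts infinitely often to receive, receives every message addressed to it. A *nice* run is a finite run without crashes in which the failure detector always returns to each process $p$ a fixed value $\nu_p$; the constant history $(\nu_p)_p$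 is one that it may output when nobody crashes. The protocol is a *leaderless SMR protocol* if, initially, every command is pending at every process and, in every run: - (Validity) committed commands, and their dependencies, were submitted before; decided commands remain decided; - aborted commands are not dependencies, and no command is committed at one process and aborted at another or the same one; - (Stability) for each $c$ there is $D$ such that $\mathrm{deps}(c)=D$ wherever and whenever $c$ is stable; - (Consistency) if conflicting $a,b$ are both committed at a process, then there $a\in\mathrm{deps}(b)$ or $b\in\mathrm{deps}(a)$; - (Fast path) when $\mathrm{announce}(c)$ returns $(D,\mathrm{true})$ with $D\in 2^{\mathcal C}$ at $\mathrm{coord}(c)$, then $\mathrm{deps}(c)$ becomes there $D$ without the aborted commands. Call the system *at rest* when no message is in transit, every submitted command is decided at every process, and every process that has taken a step is waiting for a message (so it is at rest initially). Let $0\le F$, and suppose that the protocol has the following properties. - (Reliability) In every infinite run with at most $f$ failures, every submitted command is eventually decided at every correct process. - (Optimal Latency) If $\mathrm{announce}(c)$ returns $(D,\mathit{flag})$ at $\mathrm{coord}(c)$ in a nice run, then (i) $D\in 2^{\mathcal C}$, and for every $d\in D$ the invocation of $\mathrm{announce}(d)$ happens before (in the causal order) this return; (ii) $\mathit{flag}$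 is true, unless some command conflicting with $c$ was submitted before this return and was not committed at $\mathrm{coord}(c)$ when $c$ was submitted; (iii) if the system was at rest when $c$ was submitted and no other command is submitted before the return, then the maximal number of messages on a causal path from the invocation of $\mathrm{announce}(c)$ to its return is $2$. - (Load Balancing) After every nice run that leaves the system at rest, for every command $c$ not submitted in it and every set $Q$ of at least $n-F$ processes containing $\mathrm{coord}(c)$, the run can be extended to a nice run by a finite sequence of steps which starts with the invocation and ends with a return of $\mathrm{announce}(c)$ at $\mathrm{coord}(c)$, all of whose steps lie causally between these two, in which no other command is submitted, the processes that take steps are exactly those of $Q$, and every message sent is received. Then $2F+f-1\le n$. -/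

import Mathlib

namespace Roll

/-! ### Processes, crashes, failure detectors -/

/-- A failure pattern: the set of processes that are crashed at each time; crashes are final. -/
structure FailurePattern (Proc : Type*) where
  crashed : ℕ → Set Proc
  mono : Monotone crashed

/-- The processes that crash at some time. The others are correct. -/
def FailurePattern.faulty {Proc : Type*} (A : FailurePattern Proc) : Set Proc :=
  {p | ∃ t, p ∈ A.crashed t}

/-- The failure pattern without any crash. -/
def FailurePattern.none (Proc : Type*) : FailurePattern Proc where
  crashed := fun _ => ∅
  mono := fun _ _ _ => le_rfl

/-- A realistic failure detector with range `R`: it maps each failure pattern to one or more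
histories (`H p t` is the value obtained by `p` when it queries its module at time `t`), and it
cannot forecast the future. -/
structure FailureDetector (Proc R : Type*) where
  histories : FailurePattern Proc → Set (Proc → ℕ → R)
  nonempty : ∀ A, (histories A).Nonempty
  realistic : ∀ (A B : FailurePattern Proc) (t : ℕ), (∀ s ≤ t, A.crashed s = B.crashed s) →
    ∀ H ∈ histories A, ∃ H' ∈ histories B, ∀ s ≤ t, ∀ p, H p s = H' p s

/-! ### Protocols -/

/-- Messages. The number `num` (the sender had sent `num` messages before this one) only serves to
make every message that is sent in a run unique. -/
structure Msg (Proc Payload : Type*) where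
  src : Proc
  dst : Proc
  num : ℕ
  payload : Payload

/-- The value of `deps c` at a process: pending (`⊥`), aborted (`⊤`), or committed with a set of
dependencies. -/
inductive Dep (Cmd : Type*) where
  | pending : Dep Cmd
  | aborted : Dep Cmd
  | committed (D : Set Cmd) : Dep Cmd

/-- The instruction that a process executes at its next step, with the local state that results. -/
inductive Instr (Proc Cmd R Payload State : Type*) where
  /-- Attempt to receive a message: the outcome is a sender with a content, or the null message. -/
  | recv (k : Option (Proc × Payload) → State)
  /-- Query the local failure detector module. -/
  | query (k : R → State)
  /-- Change the local state. The change may depend on a free choice, e.g. of the quorum to be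
  contacted; a deterministic change is a constant `k`. -/
  | choose (k : ℕ → State)
  /-- Send a message. -/
  | send (dst : Proc) (x : Payload) (s : State)
  /-- Return `(D, flag)` from the announcement of `c`; `D` is a set of commands or `none` (`⊤`). -/
  | respond (c : Cmd) (D : Option (Set Cmd)) (flag : Bool) (s : State)

/-- A protocol: one automaton per process. `submit` is the effect on the local state of the input
`submit c`, which at the coordinator of `c` is the invocation of `announce c`; `deps` is the
dependency graph that a process holds. -/
structure Protocol (Proc Cmd R : Type*) where
  State : Type*
  Payload : Type*
  start : Proc → State
  instr : Proc → State → Instr Proc Cmd R Payload State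
  submit : Proc → Cmd → State → State
  deps : Proc → State → Cmd → Dep Cmd

/-- What happens in a step. -/
inductive Act (Proc Cmd R Payload : Type*) where
  | submit (c : Cmd)
  | recv (m : Option (Msg Proc Payload))
  | query (v : R)
  | choose (x : ℕ)
  | send (m : Msg Proc Payload)
  | respond (c : Cmd) (D : Option (Set Cmd)) (flag : Bool)

/-- A step: a process and what it does. -/
structure Step (Proc Cmd R Payload : Type*) where
  proc : Proc
  act : Act Proc Cmd R Payload

/-- A configuration: the local states, the number of messages that each process has sent, the
messages in transit, and the commands that have been submitted. -/
structure Config (Proc Cmd State Payload : Type*) where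
  state : Proc → State
  sent : Proc → ℕ
  buff : Set (Msg Proc Payload)
  submitted : Set Cmd

namespace Protocol

variable {Proc Cmd R : Type*}

/-- The steps of a protocol. -/
abbrev St (P : Protocol Proc Cmd R) := Step Proc Cmd R P.Payload

/-- The configurations of a protocol. -/
abbrev Conf (P : Protocol Proc Cmd R) := Config Proc Cmd P.State P.Payload

/-- The initial configuration. -/
def startConf (P : Protocol Proc Cmd R) : P.Conf where
  state := P.start
  sent := fun _ => 0
  buff := ∅
  submitted := ∅

/-- The step `s` is possible in the configuration `C`. A command is submitted by its coordinator,
at any time, at most once; every other step is the instruction prescribed by the automaton. -/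
def Enabled (P : Protocol Proc Cmd R) (coord : Cmd → Proc) (C : P.Conf) (s : P.St) : Prop :=
  match s.act, P.instr s.proc (C.state s.proc) with
  | .submit c, _ => s.proc = coord c ∧ c ∉ C.submitted
  | .recv none, .recv _ => True
  | .recv (some m), .recv _ => m ∈ C.buff ∧ m.dst = s.proc
  | .query _, .query _ => True
  | .choose _, .choose _ => True
  | .send m, .send q x _ => m = ⟨s.proc, q, C.sent s.proc, x⟩
  | .respond c D flag, .respond c' D' flag' _ => c = c' ∧ D = D' ∧ flag = flag'
  | _, _ => False

/-- The local state of `p` after it does `a` in the local state `σ`. -/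
def nextState (P : Protocol Proc Cmd R) (p : Proc) (σ : P.State)
    (a : Act Proc Cmd R P.Payload) : P.State :=
  match a, P.instr p σ with
  | .submit c, _ => P.submit p c σ
  | .recv m, .recv k => k (m.map fun m => (m.src, m.payload))
  | .query v, .query k => k v
  | .choose x, .choose k => k x
  | .send _, .send _ _ σ' => σ'
  | .respond _ _ _, .respond _ _ _ σ' => σ'
  | _, _ => σ

/-- The configuration after a step. -/
def after [DecidableEq Proc] (P : Protocol Proc Cmd R) (C : P.Conf) (s : P.St) : P.Conf where
  state := Function.update C.state s.proc (P.nextState s.proc (C.state s.proc) s.act)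
  sent := match s.act with
    | .send _ => Function.update C.sent s.proc (C.sent s.proc + 1)
    | _ => C.sent
  buff := match s.act with
    | .send m => insert m C.buff
    | .recv (some m) => C.buff \ {m}
    | _ => C.buff
  submitted := match s.act with
    | .submit c => insert c C.submitted
    | _ => C.submitted

/-- The configuration after a sequence of steps, from the initial one. -/
def final [DecidableEq Proc] (P : Protocol Proc Cmd R) (l : List P.St) : P.Conf :=
  l.foldl P.after P.startConf

/-- The steps of `l` can be taken one after the other from the configuration `C`. -/
def ConformsFrom [DecidableEq Proc] (P : Protocol Proc Cmd R) (coord : Cmd → Proc) :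
    P.Conf → List P.St → Prop
  | _, [] => True
  | C, s :: l => P.Enabled coord C s ∧ ConformsFrom P coord (P.after C s) l

/-- The value of `deps c` at `p` after the steps `l`. -/
def depsAt [DecidableEq Proc] (P : Protocol Proc Cmd R) (l : List P.St) (p : Proc) (c : Cmd) :
    Dep Cmd :=
  P.deps p ((P.final l).state p) c

/-! ### Runs -/

/-- A finite run with failure pattern `A` and failure detector history `H`: a sequence of steps,
each with the time at which it is taken. -/
structure IsRun [DecidableEq Proc] (P : Protocol Proc Cmd R) (coord : Cmd → Proc)
    (A : FailurePattern Proc) (H : Proc → ℕ → R) (r : List (ℕ × P.St)) : Prop where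
  times : (r.map Prod.fst).Pairwise (· < ·)
  alive : ∀ e ∈ r, e.2.proc ∉ A.crashed e.1
  detector : ∀ e ∈ r, ∀ v, e.2.act = .query v → v = H e.2.proc e.1
  conforms : P.ConformsFrom coord P.startConf (r.map Prod.snd)

/-- The first `k` steps of an infinite sequence. -/
def upTo (P : Protocol Proc Cmd R) (σ : ℕ → ℕ × P.St) (k : ℕ) : List (ℕ × P.St) :=
  (List.range k).map σ

/-- An infinite (admissible) run: every correct process takes infinitely many steps of its
automaton, and every process that attempts infinitely often to receive a message eventually
receives every message addressed to it. -/
structure IsInfRun [DecidableEq Proc] (P : Protocol Proc Cmd R) (coord : Cmd → Proc)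
    (A : FailurePattern Proc) (H : Proc → ℕ → R) (σ : ℕ → ℕ × P.St) : Prop where
  isRun : ∀ k, P.IsRun coord A H (P.upTo σ k)
  fair : ∀ p ∉ A.faulty, ∀ k, ∃ j ≥ k, (σ j).2.proc = p ∧ ∀ c, (σ j).2.act ≠ .submit c
  reliable : ∀ p, (∀ k, ∃ j ≥ k, (σ j).2.proc = p ∧ ∃ m, (σ j).2.act = .recv m) →
    ∀ i m, (σ i).2.act = .send m → m.dst = p → ∃ j, (σ j).2 = ⟨p, .recv (some m)⟩

/-- The (finite) nice runs, as sequences of steps: no process crashes, and the failure detector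
always returns the same value `calm p` to each process `p`. -/
def Nice [DecidableEq Proc] (P : Protocol Proc Cmd R) (coord : Cmd → Proc) (calm : Proc → R)
    (l : List P.St) : Prop :=
  ∃ r : List (ℕ × P.St),
    P.IsRun coord (FailurePattern.none Proc) (fun p _ => calm p) r ∧ r.map Prod.snd = l

/-! ### Leaderless state machine replication -/

/-- `d ∈ deps^* c` for the dependency graph `g`. -/
def InClosure (g : Cmd → Dep Cmd) (c d : Cmd) : Prop :=
  Relation.ReflTransGen (fun a b => ∃ D, g a = .committed D ∧ b ∈ D) c d

/-- A command is stable once it is committed and no command of `deps^* c` is pending. -/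
def Stable (g : Cmd → Dep Cmd) (c : Cmd) : Prop :=
  (∃ D, g c = .committed D) ∧ ∀ d, InClosure g c d → g d ≠ .pending

/-- The safety properties of a leaderless state machine replication protocol that uses the failure
detector `FD` in the environment `E`. -/
structure IsLeaderlessSMR [DecidableEq Proc] (P : Protocol Proc Cmd R)
    (conflict : SimpleGraph Cmd) (coord : Cmd → Proc) (FD : FailureDetector Proc R)
    (E : Set (FailurePattern Proc)) : Prop where
  /-- Initially, every command is pending. -/
  initial : ∀ p c, P.deps p (P.start p) c = .pending
  /-- Validity: a command is committed, or is a dependency of a committed command, only if it was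
  submitted before. -/
  validity : ∀ A ∈ E, ∀ H ∈ FD.histories A, ∀ r, P.IsRun coord A H r →
    ∀ p c D, P.depsAt (r.map Prod.snd) p c = .committed D →
      c ∈ (P.final (r.map Prod.snd)).submitted ∧ D ⊆ (P.final (r.map Prod.snd)).submitted
  /-- A decided command remains decided. -/
  decided_once : ∀ A ∈ E, ∀ H ∈ FD.histories A, ∀ r, P.IsRun coord A H r →
    ∀ r', r' <+: r → ∀ p c, P.depsAt (r'.map Prod.snd) p c ≠ .pending →
      P.depsAt (r.map Prod.snd) p c ≠ .pending
  /-- An aborted command is removed from all dependencies. -/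
  removal : ∀ A ∈ E, ∀ H ∈ FD.histories A, ∀ r, P.IsRun coord A H r →
    ∀ p a, P.depsAt (r.map Prod.snd) p a = .aborted →
      ∀ c D, P.depsAt (r.map Prod.snd) p c = .committed D → a ∉ D
  /-- Processes agree on whether a command is committed or aborted. -/
  agreement : ∀ A ∈ E, ∀ H ∈ FD.histories A, ∀ r, P.IsRun coord A H r →
    ∀ r₁, r₁ <+: r → ∀ r₂, r₂ <+: r → ∀ p q c D,
      P.depsAt (r₁.map Prod.snd) p c = .committed D → P.depsAt (r₂.map Prod.snd) q c ≠ .aborted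
  /-- Stability: for each command `c` there is `D` such that `deps c = D` wherever and whenever
  `c` is stable. -/
  stability : ∀ A ∈ E, ∀ H ∈ FD.histories A, ∀ r, P.IsRun coord A H r →
    ∀ c, ∃ D, ∀ r', r' <+: r → ∀ p, Stable (P.depsAt (r'.map Prod.snd) p) c →
      P.depsAt (r'.map Prod.snd) p c = .committed D
  /-- Consistency: of two conflicting commands that are committed at a process, one is a
  dependency of the other. -/
  consistency : ∀ A ∈ E, ∀ H ∈ FD.histories A, ∀ r, P.IsRun coord A H r →
    ∀ p a b Da Db, conflict.Adj a b →
      P.depsAt (r.map Prod.snd) p a = .committed Da →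
      P.depsAt (r.map Prod.snd) p b = .committed Db → a ∈ Db ∨ b ∈ Da
  /-- Fast path: right after the announcement of `c` returns `(D, true)` at the coordinator of `c`, with
  `D` a set of commands, `c` is committed there with `D`, without the aborted commands. -/
  fastPath : ∀ A ∈ E, ∀ H ∈ FD.histories A, ∀ r, P.IsRun coord A H r → ∀ c D,
    (r.map Prod.snd).getLast? = some ⟨coord c, .respond c (some D) true⟩ →
      P.depsAt (r.map Prod.snd) (coord c) c =
        .committed {d ∈ D | P.depsAt (r.map Prod.snd) (coord c) d ≠ .aborted}

/-! ### Causality -/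

/-- There is a causal path from the `i`-th to the `j`-th step of `l` along which `k` messages are
exchanged. So the `i`-th step happens before the `j`-th one (or is equal to it) iff such a path
exists for some `k`. -/
inductive CausalPath {Payload : Type*} (l : List (Step Proc Cmd R Payload)) : ℕ → ℕ → ℕ → Prop where
  | refl {i : ℕ} (hi : i < l.length) : CausalPath l i i 0
  | sameProc {i j j' k : ℕ} {s s' : Step Proc Cmd R Payload} (h : CausalPath l i j k)
      (hj : j < j') (hs : l[j]? = some s) (hs' : l[j']? = some s') (hp : s.proc = s'.proc) :
      CausalPath l i j' k
  | message {i j j' k : ℕ} {p : Proc} {m : Msg Proc Payload} (h : CausalPath l i j k)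
      (hj : j < j') (hs : l[j]? = some ⟨p, .send m⟩)
      (hs' : l[j']? = some ⟨m.dst, .recv (some m)⟩) : CausalPath l i j' (k + 1)

/-! ### The ROLL properties -/

/-- Reliability: in every (infinite) run with at most `f` failures, every submitted command is
eventually decided, i.e. committed or aborted, at every correct process. -/
def Reliability [DecidableEq Proc] (P : Protocol Proc Cmd R) (coord : Cmd → Proc)
    (FD : FailureDetector Proc R) (E : Set (FailurePattern Proc)) (f : ℕ) : Prop :=
  ∀ A ∈ E, ∀ H ∈ FD.histories A, ∀ σ, P.IsInfRun coord A H σ → A.faulty.ncard ≤ f →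
    ∀ c, (∃ i, (σ i).2.act = .submit c) →
      ∀ q ∉ A.faulty, ∃ k, P.depsAt ((P.upTo σ k).map Prod.snd) q c ≠ .pending

/-- The system is at rest after the steps `l`: no message is in transit, every submitted command
is decided at every process, and every process that has taken a step waits for a message. -/
def AtRest [DecidableEq Proc] (P : Protocol Proc Cmd R) (l : List P.St) : Prop :=
  (P.final l).buff = ∅ ∧
  (∀ c ∈ (P.final l).submitted, ∀ p, P.depsAt l p c ≠ .pending) ∧
  ∀ s ∈ l, ∃ k, P.instr s.proc ((P.final l).state s.proc) = .recv k

/-- The command `c`, submitted at the `i`-th step of `l` and whose announcement returns at the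
`j`-th step, meets contention: a conflicting command is submitted before the announcement returns
and is not committed at the coordinator of `c` when `c` is submitted. -/
def Contended [DecidableEq Proc] (P : Protocol Proc Cmd R) (conflict : SimpleGraph Cmd)
    (coord : Cmd → Proc) (l : List P.St) (c : Cmd) (i j : ℕ) : Prop :=
  ∃ d, conflict.Adj c d ∧ (∃ i' < j, l[i']? = some ⟨coord d, .submit d⟩) ∧
    ∀ D, P.depsAt (l.take i) (coord c) d ≠ .committed D

/-- Optimal Latency: if, in a nice run, `c` is announced at the `i`-th step and its announcement
returns `(D, flag)` at the `j`-th step, then `D` is a set of commands whose announcements happen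
before this return, `flag` is true unless there is contention, and the announcement takes two
message delays (this last clause is only required when the system was at rest before the
announcement and no other command is submitted before it returns). -/
def OptimalLatency [DecidableEq Proc] (P : Protocol Proc Cmd R) (conflict : SimpleGraph Cmd)
    (coord : Cmd → Proc) (calm : Proc → R) : Prop :=
  ∀ l, P.Nice coord calm l → ∀ c D flag i j, i < j →
    l[i]? = some ⟨coord c, .submit c⟩ → l[j]? = some ⟨coord c, .respond c D flag⟩ →
    (∃ D', D = some D' ∧ ∀ d ∈ D', ∃ i' k, l[i']? = some ⟨coord d, .submit d⟩ ∧
      CausalPath l i' j k) ∧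
    (flag = true ∨ P.Contended conflict coord l c i j) ∧
    (P.AtRest (l.take i) →
      (∀ i' d, i < i' → i' < j → l[i']? ≠ some ⟨coord d, .submit d⟩) →
      IsGreatest {k | CausalPath l i j k} 2)

/-- `Γ` consists exactly of the steps of one announcement of `c`: it starts with its invocation
and ends with its return at the coordinator, every step lies causally in between, and no other
command is submitted. -/
structure IsAnnouncement {Payload : Type*} (coord : Cmd → Proc)
    (Γ : List (Step Proc Cmd R Payload)) (c : Cmd) : Prop where
  first : Γ[0]? = some ⟨coord c, .submit c⟩
  last : ∃ D flag, Γ[Γ.length - 1]? = some ⟨coord c, .respond c D flag⟩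
  between : ∀ i < Γ.length, ∃ a b, CausalPath Γ 0 i a ∧ CausalPath Γ i (Γ.length - 1) b
  only : ∀ s ∈ Γ, ∀ d, s.act = .submit d → d = c

/-- Fast path quorums of `c`: sets of at least `n - F` processes with the coordinator of `c`. -/
def IsFastQuorum [Fintype Proc] (coord : Cmd → Proc) (F : ℕ) (c : Cmd) (Q : Finset Proc) : Prop :=
  coord c ∈ Q ∧ Fintype.card Proc - F ≤ Q.card

/-- Load Balancing: after every nice run that leaves the system at rest, any fast path quorum `Q`
of a command `c` that was not submitted yet can be used to announce `c`: the processes that take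
steps are those of `Q`, and every message that is sent is received. -/
def LoadBalancing [Fintype Proc] [DecidableEq Proc] (P : Protocol Proc Cmd R)
    (coord : Cmd → Proc) (calm : Proc → R) (F : ℕ) : Prop :=
  ∀ l, P.Nice coord calm l → P.AtRest l → ∀ c ∉ (P.final l).submitted,
    ∀ Q, IsFastQuorum coord F c Q → ∃ Γ : List P.St,
      P.Nice coord calm (l ++ Γ) ∧ IsAnnouncement coord Γ c ∧
      (∀ p, p ∈ Q ↔ ∃ s ∈ Γ, s.proc = p) ∧
      ∀ s ∈ Γ, ∀ m, s.act = .send m → ∃ s' ∈ Γ, s'.act = .recv (some m)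

end Protocol

end Roll

/-!
Suppose that `n + 2 ≤ 2 * F + f`, so that `1 ≤ F` as `f < n`, and let `c₁`, `c₂` be conflicting
commands with coordinators `p₁ ≠ p₂`. Choose fast path quorums `Q₁ ∋ p₁` and `Q₂ ∋ p₂`, neither
containing the coordinator of the other command, that overlap as little as possible: in `max 0 (n -
2 * F)` processes (`exists_subsets_small_inter`). From the initial configuration, `cᵢ` can be
announced alone with the quorum `Qᵢ`, by steps `Γᵢ`; there is no contention, so this takes the fast
path, in two message delays, and `pᵢ` commits `cᵢ` with no dependency except possibly `cᵢ`
(`exists_soloFastPath`).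

Two message delays only leave time for a request from the coordinator and a reply. Hence the steps
of `p₂` before it receives any message, followed by all steps of the other processes of `Q₂ \ Q₁`,
form a possible execution `Δ₂` (`IsAnnouncement.exists_isCut`), and they remain possible after
`Γ₁`, as they concern other processes. Likewise for `Γ₂` followed by `Δ₁`. The runs `Γ₁ Δ₂` and `Γ₂
Δ₁` differ only for the processes of `K = (Q₁ ∩ Q₂) ∪ {p₁, p₂}`, and no message to another process
is in transit after them. If the quorums intersect, then `K` has at most `f` elements. If they are
disjoint, `Γ₁ Γ₂` and `Γ₂ Γ₁` are possible, they lead to the same local states, and one can take `K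
= ∅`.

Now let `K` crash, which the failure detector could not forecast, and let the other processes run
fairly after `Γ₁ Δ₂` (`exists_infRun_extension`) until some correct `q` has decided `c₁` and `c₂`.
The same continuation is possible after `Γ₂ Δ₁` (`conforms_append_of_indistinguishable`), with the
same local state of `q`. As `c₁` was committed at `p₁` in the first run and `c₂` at `p₂` in the
second one, `q` has not aborted them. Nothing else was submitted, so both are stable at `q`, and by
Stability neither is a dependency of the other. This contradicts Consistency (`false_of_cuts`).

Runs are rearranged by means of `conforms_of_local`: what is possible is determined by the local
histories of the processes, as long as messages are sent before they are received.
-/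

namespace Roll

namespace Protocol

/-! ### Local histories -/

section Local

variable {Proc Cmd R : Type*} [DecidableEq Proc]

/-- The local history of `p` in `l`: the steps of `l` that `p` takes. -/
def stepsOf {Payload : Type*} (p : Proc) (l : List (Step Proc Cmd R Payload)) :
    List (Step Proc Cmd R Payload) :=
  l.filter fun s => s.proc = p

/-- The steps `l` are possible from the initial configuration on. -/
abbrev Conforms (P : Protocol Proc Cmd R) (coord : Cmd → Proc) (l : List P.St) : Prop :=
  P.ConformsFrom coord P.startConf l

/-- Every message that is delivered in `l` is sent before in `l`. -/
def DeliveriesSent {Payload : Type*} (l : List (Step Proc Cmd R Payload)) : Prop :=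
  ∀ a b q m, l = a ++ ⟨q, .recv (some m)⟩ :: b → ∃ s ∈ a, s.act = .send m

variable {P : Protocol Proc Cmd R} {coord : Cmd → Proc}

omit [DecidableEq Proc] in
theorem enabled_recv_iff {C : P.Conf} {p : Proc} {m : Msg Proc P.Payload} :
    P.Enabled coord C ⟨p, .recv (some m)⟩ ↔
      (∃ k, P.instr p (C.state p) = .recv k) ∧ m ∈ C.buff ∧ m.dst = p := by
  unfold Enabled
  cases P.instr p (C.state p) <;> simp

omit [DecidableEq Proc] in
theorem enabled_submit_iff {C : P.Conf} {p : Proc} {c : Cmd} :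
    P.Enabled coord C ⟨p, .submit c⟩ ↔ p = coord c ∧ c ∉ C.submitted := by
  unfold Enabled
  cases P.instr p (C.state p) <;> simp

omit [DecidableEq Proc] in
theorem Enabled.eq_of_send {C : P.Conf} {p : Proc} {m : Msg Proc P.Payload}
    (h : P.Enabled coord C ⟨p, .send m⟩) : m.src = p ∧ m.num = C.sent p := by
  unfold Enabled at h
  cases h' : P.instr p (C.state p) <;> simp [h'] at h
  simp [h]

omit [DecidableEq Proc] in
/-- Apart from the messages in transit and the submitted commands, only the part of the
configuration that belongs to the process taking the step matters. -/
theorem Enabled.congr {C C' : P.Conf} {s : P.St} (h : P.Enabled coord C s)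
    (hst : C'.state s.proc = C.state s.proc) (hsent : C'.sent s.proc = C.sent s.proc)
    (hbuff : ∀ m, s.act = .recv (some m) → m ∈ C'.buff)
    (hsub : ∀ c, s.act = .submit c → c ∉ C'.submitted) : P.Enabled coord C' s := by
  obtain ⟨p, a⟩ := s
  simp only at hst hsent hbuff hsub
  cases a with
  | submit c => exact enabled_submit_iff.2 ⟨(enabled_submit_iff.1 h).1, hsub c rfl⟩
  | recv o =>
    cases o with
    | none =>
      unfold Enabled at h ⊢
      cases hi : P.instr p (C.state p) <;> simp_all
    | some m =>
      obtain ⟨h1, -, h2⟩ := enabled_recv_iff.1 h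
      exact enabled_recv_iff.2 ⟨by rwa [hst], hbuff m rfl, h2⟩
  | _ =>
    unfold Enabled at h ⊢
    cases hi : P.instr p (C.state p) <;> simp_all

@[simp] theorem final_nil : P.final [] = P.startConf := rfl

theorem final_concat (l : List P.St) (s : P.St) :
    P.final (l ++ [s]) = P.after (P.final l) s := by
  simp [final]

theorem conformsFrom_append {C : P.Conf} {l l' : List P.St} :
    P.ConformsFrom coord C (l ++ l') ↔
      P.ConformsFrom coord C l ∧ P.ConformsFrom coord (l.foldl P.after C) l' := by
  induction l generalizing C with
  | nil => simp [ConformsFrom]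
  | cons s l ih => simp [ConformsFrom, ih, and_assoc]

theorem conforms_concat {l : List P.St} {s : P.St} :
    P.Conforms coord (l ++ [s]) ↔ P.Conforms coord l ∧ P.Enabled coord (P.final l) s := by
  simp [Conforms, conformsFrom_append, ConformsFrom, final]

theorem Conforms.left {l l' : List P.St} (h : P.Conforms coord (l ++ l')) :
    P.Conforms coord l := (conformsFrom_append.1 h).1

theorem Conforms.enabled {a b : List P.St} {s : P.St} (h : P.Conforms coord (a ++ s :: b)) :
    P.Enabled coord (P.final a) s := by
  rw [List.append_cons] at h
  exact (conforms_concat.1 h.left).2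

theorem stepsOf_append {Payload : Type*} (p : Proc) (l l' : List (Step Proc Cmd R Payload)) :
    stepsOf p (l ++ l') = stepsOf p l ++ stepsOf p l' := List.filter_append ..

theorem mem_stepsOf {Payload : Type*} {p : Proc} {l : List (Step Proc Cmd R Payload)}
    {s : Step Proc Cmd R Payload} : s ∈ stepsOf p l ↔ s ∈ l ∧ s.proc = p := by
  simp [stepsOf]

theorem stepsOf_concat {Payload : Type*} (p : Proc) (l : List (Step Proc Cmd R Payload))
    (s : Step Proc Cmd R Payload) :
    stepsOf p (l ++ [s]) = stepsOf p l ++ if s.proc = p then [s] else [] := by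
  by_cases h : s.proc = p <;> simp [stepsOf, h]

theorem state_final (l : List P.St) (p : Proc) :
    (P.final l).state p =
      (stepsOf p l).foldl (fun σ s => P.nextState p σ s.act) (P.start p) := by
  induction l using List.reverseRecOn with
  | nil => rfl
  | append_singleton l s ih =>
    rw [final_concat, stepsOf_concat, List.foldl_append, ← ih]
    by_cases h : s.proc = p
    · subst h; simp [after]
    · simp [after, h, Function.update_of_ne (Ne.symm h)]

/-- Whether an action sends a message. -/
def isSend {Payload : Type*} : Act Proc Cmd R Payload → Bool
  | .send _ => true
  | _ => false

theorem sent_final (l : List P.St) (p : Proc) :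
    (P.final l).sent p = (stepsOf p l).countP fun s => isSend s.act := by
  induction l using List.reverseRecOn with
  | nil => rfl
  | append_singleton l s ih =>
    rw [final_concat, stepsOf_concat, List.countP_append, ← ih]
    obtain ⟨q, a⟩ := s
    by_cases h : q = p
    · subst h; cases a <;> simp [after, isSend]
    · cases a <;> simp [after, h, Function.update_of_ne (Ne.symm h)]

theorem state_final_congr {l l' : List P.St} {p : Proc} (h : stepsOf p l = stepsOf p l') :
    (P.final l).state p = (P.final l').state p := by rw [state_final, state_final, h]

theorem sent_final_congr {l l' : List P.St} {p : Proc} (h : stepsOf p l = stepsOf p l') :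
    (P.final l).sent p = (P.final l').sent p := by rw [sent_final, sent_final, h]

theorem mem_submitted_final {l : List P.St} {c : Cmd} :
    c ∈ (P.final l).submitted ↔ ∃ s ∈ l, s.act = .submit c := by
  induction l using List.reverseRecOn with
  | nil => simp [startConf]
  | append_singleton l s ih =>
    obtain ⟨q, a⟩ := s
    rw [final_concat]
    cases a <;> simp [after, ih, or_and_right, exists_or, eq_comm, or_comm]

/-! ### Messages -/

theorem Conforms.num_lt {l : List P.St} (hl : P.Conforms coord l) :
    ∀ s ∈ l, ∀ m, s.act = .send m → m.num < (P.final l).sent m.src := by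
  induction l using List.reverseRecOn with
  | nil => simp
  | append_singleton l s ih =>
    obtain ⟨hl, hs⟩ := conforms_concat.1 hl
    rw [final_concat]
    intro s' hs' m hm
    rcases List.mem_append.1 hs' with hs' | hs'
    · refine (ih hl s' hs' m hm).trans_le ?_
      obtain ⟨q, a⟩ := s
      cases a <;> simp [after, Function.update_apply]
      split_ifs with h <;> simp [h]
    · obtain rfl := List.mem_singleton.1 hs'
      obtain ⟨q, a⟩ := s'
      obtain rfl : a = .send m := hm
      obtain ⟨h1, h2⟩ := hs.eq_of_send
      simp [after, h1, h2]

/-- A sent message is determined by its sender and its number. -/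
theorem Conforms.msg_unique {l : List P.St} (hl : P.Conforms coord l) :
    ∀ s ∈ l, ∀ m, s.act = .send m → ∀ s' ∈ l, ∀ m', s'.act = .send m' →
      m.src = m'.src → m.num = m'.num → m = m' := by
  induction l using List.reverseRecOn with
  | nil => simp
  | append_singleton l s ih =>
    obtain ⟨hl, hs⟩ := conforms_concat.1 hl
    -- The new message has a number that no earlier message of its sender has.
    have key : ∀ s' ∈ l, ∀ m m', s.act = .send m → s'.act = .send m' → m.src = m'.src →
        m.num = m'.num → False := by
      intro s' hs' m m' hm hm' h1 h2
      have := hl.num_lt s' hs' m' hm'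
      obtain ⟨q, a⟩ := s
      obtain rfl : a = .send m := hm
      obtain ⟨h3, h4⟩ := hs.eq_of_send
      rw [← h1, ← h2, h3, h4] at this
      exact this.false
    intro s₁ h₁ m₁ hm₁ s₂ h₂ m₂ hm₂ e1 e2
    rcases List.mem_append.1 h₁ with i₁ | i₁ <;> rcases List.mem_append.1 h₂ with i₂ | i₂
    · exact ih hl s₁ i₁ m₁ hm₁ s₂ i₂ m₂ hm₂ e1 e2
    · rw [List.mem_singleton.1 i₂] at hm₂
      exact (key _ i₁ m₂ m₁ hm₂ hm₁ e1.symm e2.symm).elim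
    · rw [List.mem_singleton.1 i₁] at hm₁
      exact (key _ i₂ m₁ m₂ hm₁ hm₂ e1 e2).elim
    · rw [List.mem_singleton.1 i₁] at hm₁
      rw [List.mem_singleton.1 i₂, hm₁] at hm₂
      simpa using hm₂

theorem Conforms.mem_enabled {l : List P.St} (hl : P.Conforms coord l) {s : P.St} (hs : s ∈ l) :
    ∃ a b, l = a ++ s :: b ∧ P.Enabled coord (P.final a) s := by
  obtain ⟨a, b, rfl⟩ := List.append_of_mem hs
  exact ⟨a, b, rfl, hl.enabled⟩

theorem mem_buff_final {l : List P.St} {m : Msg Proc P.Payload} (h : m ∈ (P.final l).buff) :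
    ∃ s ∈ l, s.act = .send m := by
  induction l using List.reverseRecOn with
  | nil => simp [startConf] at h
  | append_singleton l s ih =>
    rw [final_concat] at h
    obtain ⟨q, a⟩ := s
    cases a with
    | send m' =>
      rcases h with rfl | h
      · exact ⟨_, List.mem_concat_self, rfl⟩
      · obtain ⟨s, h1, h2⟩ := ih h
        exact ⟨s, by simp [h1], h2⟩
    | recv o =>
      have h' : m ∈ (P.final l).buff := by cases o <;> simp_all [after]
      obtain ⟨s, h1, h2⟩ := ih h'
      exact ⟨s, by simp [h1], h2⟩
    | _ =>
      obtain ⟨s, h1, h2⟩ := ih h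
      exact ⟨s, by simp [h1], h2⟩

theorem Conforms.deliveriesSent {l : List P.St} (hl : P.Conforms coord l) : DeliveriesSent l := by
  rintro a b q m rfl
  exact mem_buff_final (enabled_recv_iff.1 hl.enabled).2.1

theorem Conforms.proc_eq_dst {l : List P.St} (hl : P.Conforms coord l) {s : P.St} (hs : s ∈ l)
    {m : Msg Proc P.Payload} (hm : s.act = .recv (some m)) : s.proc = m.dst := by
  obtain ⟨a, b, -, h⟩ := hl.mem_enabled hs
  obtain ⟨q, x⟩ := s
  obtain rfl : x = .recv (some m) := hm
  exact (enabled_recv_iff.1 h).2.2.symm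

theorem Conforms.proc_eq_coord {l : List P.St} (hl : P.Conforms coord l) {s : P.St} (hs : s ∈ l)
    {c : Cmd} (hc : s.act = .submit c) : s.proc = coord c := by
  obtain ⟨a, b, -, h⟩ := hl.mem_enabled hs
  obtain ⟨q, x⟩ := s
  obtain rfl : x = .submit c := hc
  exact (enabled_submit_iff.1 h).1

/-- As no message is sent twice, the messages in transit are those sent but not yet received. -/
theorem Conforms.mem_buff {l : List P.St} (hl : P.Conforms coord l) (m : Msg Proc P.Payload) :
    m ∈ (P.final l).buff ↔
      (∃ s ∈ l, s.act = .send m) ∧ ∀ s ∈ l, s.act ≠ .recv (some m) := by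
  induction l using List.reverseRecOn generalizing m with
  | nil => simp [startConf]
  | append_singleton l s ih =>
    obtain ⟨hl', hs⟩ := conforms_concat.1 hl
    rw [final_concat]
    have hm := ih hl' m
    obtain ⟨q, a⟩ := s
    cases a with
    | send m' =>
      by_cases e : m = m'
      · subst e
        have hr : ∀ s ∈ l, s.act ≠ .recv (some m) := by
          -- Otherwise `m` would have been sent before already.
          intro s hs' he
          obtain ⟨a, b, hab, h⟩ := hl'.mem_enabled hs'
          obtain ⟨p, x⟩ := s
          obtain rfl : x = .recv (some m) := he
          obtain ⟨s, h1, h2⟩ := mem_buff_final (enabled_recv_iff.1 h).2.1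
          have := hl'.num_lt s (by simp [hab, h1]) m h2
          obtain ⟨h3, h4⟩ := hs.eq_of_send
          rw [h3, h4] at this
          exact this.false
        simp only [after, Set.mem_insert_iff, true_or, true_iff]
        refine ⟨⟨_, List.mem_concat_self, rfl⟩, fun s h => ?_⟩
        rcases List.mem_append.1 h with h | h
        · exact hr s h
        · simp [List.mem_singleton.1 h]
      · have : m' ≠ m := Ne.symm e
        simpa [after, e, this, or_imp, forall_and, or_and_right, exists_or] using hm
    | recv o =>
      cases o with
      | none => simpa [after, or_imp, forall_and, or_and_right, exists_or] using hm
      | some m' =>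
        by_cases e : m = m'
        · subst e
          simp [after, or_imp, forall_and]
        · have : m' ≠ m := Ne.symm e
          simpa [after, e, this, or_imp, forall_and, or_and_right, exists_or] using hm
    | _ => simpa [after, or_imp, forall_and, or_and_right, exists_or] using hm

/-! ### Rearranging runs -/

/-- Indistinguishability: if every process has in `l` a local history that it has in (the
beginning of) some sequence of steps that is possible, and no message is received before it is
sent, then `l` is possible too. -/
theorem conforms_of_local {l : List P.St} (hsent : DeliveriesSent l)
    (hloc : ∀ p, ∃ l', P.Conforms coord l' ∧ stepsOf p l <+: stepsOf p l') :
    P.Conforms coord l := by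
  induction l using List.reverseRecOn with
  | nil => trivial
  | append_singleton l s ih =>
    have hl : P.Conforms coord l := by
      refine ih (fun a b q m h => hsent a (b ++ [s]) q m (by simp [h])) fun p => ?_
      obtain ⟨l', h1, h2⟩ := hloc p
      rw [stepsOf_append] at h2
      exact ⟨l', h1, (List.prefix_append ..).trans h2⟩
    refine conforms_concat.2 ⟨hl, ?_⟩
    obtain ⟨l', hl', t, ht⟩ := hloc s.proc
    rw [stepsOf_concat, if_pos rfl, List.append_assoc, List.singleton_append] at ht
    obtain ⟨a, b, hab, ha, hb⟩ := List.filter_eq_append_iff.1 ht.symm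
    obtain ⟨b₁, b₂, rfl, hb₁, -, -⟩ := List.filter_eq_cons_iff.1 hb
    have hloc' : stepsOf s.proc (a ++ b₁) = stepsOf s.proc l := by
      rw [stepsOf_append, ← ha]
      simpa [stepsOf] using hb₁
    rw [← List.append_assoc] at hab
    subst hab
    have hen := hl'.enabled
    refine hen.congr (state_final_congr hloc'.symm) (sent_final_congr hloc'.symm) ?_ ?_
    · intro m hm
      obtain ⟨p, x⟩ := s
      obtain rfl : x = .recv (some m) := hm
      refine (hl.mem_buff m).2 ⟨hsent l [] p m rfl, fun s' hs' he => ?_⟩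
      obtain ⟨-, h1, h2⟩ := enabled_recv_iff.1 hen
      have h3 : s' ∈ stepsOf p l := mem_stepsOf.2 ⟨hs', (hl.proc_eq_dst hs' he).trans h2⟩
      rw [← hloc'] at h3
      exact ((hl'.left.mem_buff m).1 h1).2 s' (mem_stepsOf.1 h3).1 he
    · intro c hc h
      obtain ⟨p, x⟩ := s
      obtain rfl : x = .submit c := hc
      obtain ⟨s', hs', he⟩ := mem_submitted_final.1 h
      obtain ⟨h1, h2⟩ := enabled_submit_iff.1 hen
      have h3 : s' ∈ stepsOf p l := mem_stepsOf.2 ⟨hs', (hl.proc_eq_coord hs' he).trans h1.symm⟩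
      rw [← hloc'] at h3
      exact h2 (mem_submitted_final.2 ⟨s', (mem_stepsOf.1 h3).1, he⟩)

theorem append_eq_append_cons {α : Type*} {l l' a b : List α} {x : α}
    (h : l ++ l' = a ++ x :: b) :
    (∃ t, l = a ++ x :: t) ∨ ∃ t, a = l ++ t ∧ l' = t ++ x :: b := by
  rcases List.append_eq_append_iff.1 h with h | ⟨t, rfl, ht⟩
  · exact .inr h
  · cases t with
    | nil => exact .inr ⟨[], by simp, ht.symm⟩
    | cons y t =>
      obtain ⟨rfl, -⟩ := List.cons_eq_cons.1 ht
      exact .inl ⟨t, rfl⟩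

omit [DecidableEq Proc] in
theorem DeliveriesSent.append {Payload : Type*} {l l' : List (Step Proc Cmd R Payload)}
    (h : DeliveriesSent l) (h' : DeliveriesSent l') : DeliveriesSent (l ++ l') := by
  intro a b q m e
  rcases append_eq_append_cons e with ⟨t, rfl⟩ | ⟨t, rfl, e'⟩
  · exact h a t q m rfl
  · obtain ⟨s, h1, h2⟩ := h' t b q m e'
    exact ⟨s, List.mem_append_right _ h1, h2⟩

/-- If the processes outside `K` have the same local histories in `l₁` and in `l₂`, and no message
to them is in transit after `l₁`, then whatever they can do after `l₁` they can do after `l₂`. -/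
theorem conforms_append_of_indistinguishable {K : Finset Proc} {l₁ l₂ ρ : List P.St}
    (h₁ : P.Conforms coord (l₁ ++ ρ)) (h₂ : P.Conforms coord l₂) (hρ : ∀ s ∈ ρ, s.proc ∉ K)
    (hloc : ∀ p ∉ K, stepsOf p l₁ = stepsOf p l₂)
    (hrecv : ∀ s ∈ l₁, ∀ m, s.act = .send m → m.dst ∉ K →
      ∃ s' ∈ l₁, s'.act = .recv (some m)) : P.Conforms coord (l₂ ++ ρ) := by
  refine conforms_of_local (fun a b q m e => ?_) fun p => ?_
  · rcases append_eq_append_cons e with ⟨t, rfl⟩ | ⟨t, rfl, rfl⟩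
    · exact h₂.deliveriesSent a t q m rfl
    · rw [← List.append_assoc] at h₁
      obtain ⟨-, hm, hdst⟩ := enabled_recv_iff.1 h₁.enabled
      obtain ⟨⟨s, hs, hs'⟩, hno⟩ := (h₁.left.mem_buff m).1 hm
      rcases List.mem_append.1 hs with hs | hs
      · have : q ∉ K := hρ ⟨q, .recv (some m)⟩ (by simp)
        obtain ⟨s', h3, h4⟩ := hrecv s hs m hs' (hdst ▸ this)
        exact absurd h4 (hno s' (List.mem_append_left _ h3))
      · exact ⟨s, List.mem_append_right _ hs, hs'⟩
  · by_cases hp : p ∈ K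
    · refine ⟨l₂, h₂, ?_⟩
      have : stepsOf p ρ = [] := by
        refine List.filter_eq_nil_iff.2 fun s hs => ?_
        simp only [decide_eq_true_eq]
        rintro rfl
        exact hρ s hs hp
      rw [stepsOf_append, this, List.append_nil]
    · exact ⟨_, h₁, by rw [stepsOf_append, stepsOf_append, hloc p hp]⟩

end Local

/-! ### Causality inside a two-delay announcement -/

section Causality

variable {Proc Cmd R : Type*}

theorem CausalPath.trans {Payload : Type*} {l : List (Step Proc Cmd R Payload)} {i j k a b : ℕ}
    (h : CausalPath l i j a) (h' : CausalPath l j k b) : CausalPath l i k (a + b) := by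
  induction h' with
  | refl => exact h
  | sameProc _ hj hs hs' hp ih => exact ih.sameProc hj hs hs' hp
  | message _ hj hs hs' ih => exact ih.message hj hs hs'

theorem CausalPath.proc_eq {Payload : Type*} {l : List (Step Proc Cmd R Payload)} {i j k : ℕ}
    (h : CausalPath l i j k) (hk : k = 0) {s s' : Step Proc Cmd R Payload}
    (hs : l[i]? = some s) (hs' : l[j]? = some s') : s.proc = s'.proc := by
  induction h generalizing s' with
  | refl => simp_all
  | sameProc _ hj h1 h2 hp ih =>
    rw [h2] at hs'
    obtain rfl := Option.some.inj hs'
    exact (ih hk h1).trans hp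
  | message => omega

variable [DecidableEq Proc]

/-- Whether an action receives a (non-null) message. -/
def isDelivery {Payload : Type*} : Act Proc Cmd R Payload → Bool
  | .recv (some _) => true
  | _ => false

variable {P : Protocol Proc Cmd R} {coord : Cmd → Proc}

/-- In an announcement that takes two message delays, a process other than the coordinator only
receives messages that the coordinator sends before it receives any message itself. -/
theorem IsAnnouncement.sent_before_delivery {Γ : List P.St} {c : Cmd}
    (hΓ : P.Conforms coord Γ) (hc : IsAnnouncement coord Γ c)
    (hlat : ∀ k, CausalPath Γ 0 (Γ.length - 1) k → k ≤ 2) {a b : List P.St} {q : Proc}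
    {m : Msg Proc P.Payload} (hab : Γ = a ++ ⟨q, .recv (some m)⟩ :: b) (hq : q ≠ coord c) :
    ∃ a₁ a₂, a = a₁ ++ ⟨coord c, .send m⟩ :: a₂ ∧
      ∀ s ∈ stepsOf (coord c) a₁, isDelivery s.act = false := by
  obtain ⟨s, hs, hm⟩ := hΓ.deliveriesSent a b q m hab
  obtain ⟨a₁, a₂, rfl⟩ := List.append_of_mem hs
  obtain ⟨p, x⟩ := s
  obtain rfl : x = .send m := hm
  obtain ⟨D, flag, hlast⟩ := hc.last
  have hi : Γ[a₁.length]? = some ⟨p, .send m⟩ := by simp [hab]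
  have hj : Γ[(a₁ ++ ⟨p, .send m⟩ :: a₂).length]? = some ⟨q, .recv (some m)⟩ := by
    rw [hab]; simp
  have hdst : q = m.dst := hΓ.proc_eq_dst (s := ⟨q, .recv (some m)⟩) (by simp [hab]) rfl
  have hlt : ∀ {i : ℕ} {s : P.St}, Γ[i]? = some s → i < Γ.length := fun h =>
    (List.getElem?_eq_some_iff.1 h).1
  obtain ⟨-, y, -, hy⟩ := hc.between _ (hlt hj)
  -- The path back from `q` to the coordinator exchanges a message.
  have hy0 : y ≠ 0 := fun h => hq (hy.proc_eq h hj hlast)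
  have hback : CausalPath Γ a₁.length (Γ.length - 1) (1 + y) := by
    refine CausalPath.trans ?_ hy
    exact (CausalPath.refl (hlt hi)).message (by simp) hi (hdst ▸ hj)
  -- So no message is exchanged on the way to the sending of `m`.
  have hfwd : ∀ k, CausalPath Γ 0 a₁.length k → k = 0 := by
    intro k hk
    have := hlat _ (hk.trans hback)
    omega
  obtain ⟨x, -, hx, -⟩ := hc.between _ (hlt hi)
  obtain rfl : coord c = p := hx.proc_eq (hfwd x hx) hc.first hi
  refine ⟨a₁, a₂, rfl, fun s hs => ?_⟩
  obtain ⟨hs, hsp⟩ := mem_stepsOf.1 hs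
  obtain ⟨p', x'⟩ := s
  obtain rfl : p' = coord c := hsp
  cases x' with
  | recv o =>
    cases o with
    | none => rfl
    | some m' =>
      exfalso
      obtain ⟨a₃, a₄, rfl⟩ := List.append_of_mem hs
      have hab' : Γ = a₃ ++ ⟨coord c, .recv (some m')⟩ ::
        (a₄ ++ ⟨coord c, .send m⟩ :: (a₂ ++ ⟨q, .recv (some m)⟩ :: b)) := by simp [hab]
      obtain ⟨s', hs', hm'⟩ := hΓ.deliveriesSent _ _ _ _ hab'
      obtain ⟨a₅, a₆, rfl⟩ := List.append_of_mem hs'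
      obtain ⟨r, z⟩ := s'
      obtain rfl : z = .send m' := hm'
      have h1 : Γ[a₅.length]? = some ⟨r, .send m'⟩ := by simp [hab']
      have h2 : Γ[(a₅ ++ ⟨r, .send m'⟩ :: a₆).length]? = some ⟨coord c, .recv (some m')⟩ := by
        rw [hab']; simp
      have hdst' : coord c = m'.dst :=
        hΓ.proc_eq_dst (s := ⟨coord c, .recv (some m')⟩) (by simp [hab']) rfl
      obtain ⟨w, -, hw, -⟩ := hc.between _ (hlt h1)
      have h3 := (hw.message (by simp) h1 (hdst' ▸ h2)).sameProc (by simp) h2 hi rfl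
      exact absurd (hfwd _ h3) (by omega)
  | _ => rfl

/-- `Δ` is a part of `Γ` that can be executed on its own, and in which the processes outside `K`
take the same steps as in `Γ`. -/
structure IsCut {Payload : Type*} (K : Finset Proc) (Γ Δ : List (Step Proc Cmd R Payload)) :
    Prop where
  steps_prefix : ∀ p, stepsOf p Δ <+: stepsOf p Γ
  sent : DeliveriesSent Δ
  steps_eq : ∀ p ∉ K, stepsOf p Δ = stepsOf p Γ

theorem IsCut.subset {Payload : Type*} {K : Finset Proc} {Γ Δ : List (Step Proc Cmd R Payload)}
    (h : IsCut K Γ Δ) : Δ ⊆ Γ := fun s hs =>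
  (mem_stepsOf.1 ((h.steps_prefix s.proc).subset (mem_stepsOf.2 ⟨hs, rfl⟩))).1

theorem IsCut.refl {Γ : List P.St} (hΓ : P.Conforms coord Γ) (K : Finset Proc) : IsCut K Γ Γ :=
  ⟨fun _ => List.prefix_rfl, hΓ.deliveriesSent, fun _ _ => rfl⟩

/-- In an announcement that takes two message delays, the steps of the coordinator before it
receives a message, followed by all steps of any other processes, are possible. -/
theorem IsAnnouncement.exists_isCut {Γ : List P.St} {c : Cmd}
    (hΓ : P.Conforms coord Γ) (hc : IsAnnouncement coord Γ c)
    (hlat : ∀ k, CausalPath Γ 0 (Γ.length - 1) k → k ≤ 2) (X K : Finset Proc)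
    (hX : coord c ∉ X) (hK : coord c ∈ K) (hXK : ∀ s ∈ Γ, s.proc ∉ K → s.proc ∈ X) :
    ∃ Δ, IsCut K Γ Δ ∧ ⟨coord c, .submit c⟩ ∈ Δ ∧ ∀ s ∈ Δ, s.proc = coord c ∨ s.proc ∈ X := by
  set pre := (stepsOf (coord c) Γ).takeWhile fun s => !isDelivery s.act with hpre
  set post := Γ.filter fun s => s.proc ∈ X with hpost
  have hpre_mem : ∀ s ∈ pre, s.proc = coord c := fun s hs =>
    (mem_stepsOf.1 ((List.takeWhile_prefix _).subset hs)).2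
  have hpre_steps : ∀ p ≠ coord c, stepsOf p pre = [] := by
    intro p hp
    refine List.filter_eq_nil_iff.2 fun s hs => ?_
    simpa [hpre_mem s hs] using hp.symm
  have hpost_steps : ∀ p ∈ X, stepsOf p post = stepsOf p Γ := by
    intro p hp
    simp only [stepsOf, hpost, List.filter_filter]
    refine List.filter_congr fun s _ => ?_
    by_cases h : s.proc = p <;> simp [h, hp]
  have hpost_steps' : ∀ p ∉ X, stepsOf p post = [] := by
    intro p hp
    refine List.filter_eq_nil_iff.2 fun s hs => ?_
    have := (List.mem_filter.1 hs).2
    simp only [decide_eq_true_eq] at this ⊢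
    rintro rfl
    exact hp this
  have hsteps : ∀ p ∈ X, stepsOf p (pre ++ post) = stepsOf p Γ := by
    intro p hp
    rw [stepsOf_append, hpre_steps p (by rintro rfl; exact hX hp), hpost_steps p hp,
      List.nil_append]
  refine ⟨pre ++ post, ⟨fun p => ?_, ?_, fun p hp => ?_⟩, ?_, fun s hs => ?_⟩
  · by_cases hpX : p ∈ X
    · rw [hsteps p hpX]
    · rw [stepsOf_append, hpost_steps' p hpX, List.append_nil]
      by_cases hp : p = coord c
      · have : stepsOf p pre = pre := by
          subst hp
          exact List.filter_eq_self.2 fun s hs => by simpa using hpre_mem s hs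
        rw [this, hp]
        exact List.takeWhile_prefix _
      · simp [hpre_steps p hp]
  · intro a b q m e
    have hno_pre : ∀ s ∈ pre, isDelivery s.act = false := fun s hs => by
      simpa using List.mem_takeWhile_imp hs
    obtain ⟨t, rfl, e'⟩ := (append_eq_append_cons e).resolve_left fun ⟨t, e'⟩ => by
      simpa [isDelivery] using hno_pre ⟨q, .recv (some m)⟩ (by simp [e'])
    obtain ⟨l₁, l₂, hΓ', -, hl₂⟩ := List.filter_eq_append_iff.1 (hpost.symm.trans e')
    obtain ⟨l₃, l₄, rfl, -, hqX, -⟩ := List.filter_eq_cons_iff.1 hl₂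
    rw [← List.append_assoc] at hΓ'
    have hq : q ≠ coord c := by
      rintro rfl
      simp [hX] at hqX
    obtain ⟨a₁, a₂, ha, hno⟩ := hc.sent_before_delivery hΓ hlat hΓ' hq
    refine ⟨⟨coord c, .send m⟩, List.mem_append_left _ ?_, rfl⟩
    rw [hpre, hΓ', ha, List.append_assoc, stepsOf_append, List.takeWhile_append_of_pos]
    · simp [stepsOf, isDelivery]
    · simpa using hno
  · by_cases hpX : p ∈ X
    · exact hsteps p hpX
    · have hp' : p ≠ coord c := by rintro rfl; exact hp hK
      rw [stepsOf_append, hpost_steps' p hpX, hpre_steps p hp']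
      refine (List.filter_eq_nil_iff.2 fun s hs => ?_).symm
      simp only [decide_eq_true_eq]
      rintro rfl
      exact hpX (hXK s hs hp)
  · have h0 := hc.first
    cases Γ with
    | nil => simp at h0
    | cons s l =>
      obtain rfl : s = _ := by simpa using h0
      simp [hpre, stepsOf, isDelivery]
  · rcases List.mem_append.1 hs with hs | hs
    · exact .inl (hpre_mem s hs)
    · exact .inr (by simpa using (List.mem_filter.1 hs).2)

end Causality

/-! ### Fair infinite extensions -/

section Extension

variable {Proc Cmd R : Type*}

/-- The pattern in which the processes of `K` crash together, right after time `T`. -/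
def _root_.Roll.FailurePattern.crashAfter (T : ℕ) (K : Finset Proc) : FailurePattern Proc where
  crashed t := {p | T < t ∧ p ∈ K}
  mono _ _ h _ hp := ⟨hp.1.trans_le h, hp.2⟩

theorem _root_.Roll.FailurePattern.faulty_crashAfter (T : ℕ) (K : Finset Proc) :
    (FailurePattern.crashAfter T K).faulty = K := by
  ext p
  exact ⟨fun ⟨_, h⟩ => h.2, fun h => ⟨T + 1, by simp, h⟩⟩

/-- The steps `l`, taken at times `0`, `1`, … -/
def timed {α : Type*} (l : List α) : List (ℕ × α) := l.mapIdx Prod.mk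

theorem map_snd_timed {α : Type*} (l : List α) : (timed l).map Prod.snd = l := by
  apply List.ext_getElem <;> simp [timed]

theorem map_fst_timed {α : Type*} (l : List α) :
    (timed l).map Prod.fst = List.range l.length := by
  apply List.ext_getElem <;> simp [timed]

theorem mem_timed {α : Type*} {l : List α} {e : ℕ × α} (h : e ∈ timed l) :
    e.1 < l.length ∧ e.2 ∈ l := by
  obtain ⟨i, hi, rfl⟩ := List.mem_mapIdx.1 h
  exact ⟨hi, List.getElem_mem hi⟩

theorem timed_prefix {α : Type*} (l l' : List α) : timed l <+: timed (l ++ l') := by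
  simp [timed, List.mapIdx_append]

variable {P : Protocol Proc Cmd R} {coord : Cmd → Proc}

/-- A process always has a next step of its automaton; when it attempts to receive, it may be given
a message in transit to it with the least number. -/
theorem exists_step (coord : Cmd → Proc) (C : P.Conf) (p : Proc) (v : R) :
    ∃ a, P.Enabled coord C ⟨p, a⟩ ∧ (∀ c, a ≠ .submit c) ∧ (∀ w, a = .query w → w = v) ∧
      ∀ o, a = .recv o → ∀ m ∈ C.buff, m.dst = p → ∃ m', o = some m' ∧ m'.num ≤ m.num := by
  cases hi : P.instr p (C.state p) with
  | recv k =>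
    by_cases hm : {m ∈ C.buff | m.dst = p}.Nonempty
    · refine ⟨.recv (some (Function.argminOn Msg.num _ hm)), ?_, by simp, by simp, ?_⟩
      · exact enabled_recv_iff.2 ⟨⟨k, hi⟩, Function.argminOn_mem Msg.num _ hm⟩
      · rintro o ho m hm₁ hm₂
        exact ⟨_, (Act.recv.inj ho).symm,
          Function.argminOn_le Msg.num _ (show m ∈ {m ∈ C.buff | m.dst = p} from ⟨hm₁, hm₂⟩)⟩
    · refine ⟨.recv none, by simp [Enabled, hi], by simp, by simp, ?_⟩
      intro o _ m hm₁ hm₂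
      exact absurd ⟨m, hm₁, hm₂⟩ hm
  | query k => exact ⟨.query v, by simp [Enabled, hi], by simp, by simp, by simp⟩
  | choose k => exact ⟨.choose 0, by simp [Enabled, hi], by simp, by simp, by simp⟩
  | send q x s =>
    exact ⟨.send ⟨p, q, C.sent p, x⟩, by simp [Enabled, hi], by simp, by simp, by simp⟩
  | respond c D flag s =>
    exact ⟨.respond c D flag, by simp [Enabled, hi], by simp, by simp, by simp⟩

/-- A schedule in which the processes outside `K`, and no others, occur infinitely often. -/
theorem exists_schedule [Fintype Proc] {K : Finset Proc} (hK : K.card < Fintype.card Proc) :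
    ∃ π : ℕ → Proc, (∀ k, π k ∉ K) ∧ ∀ p ∉ K, ∀ k, ∃ j ≥ k, π j = p := by
  obtain ⟨q, hq⟩ : ∃ q, q ∉ K := by
    obtain ⟨q, -, hq⟩ := Finset.exists_mem_notMem_of_card_lt_card (s := K) (t := Finset.univ) hK
    exact ⟨q, hq⟩
  have : Nonempty {p // p ∉ K} := ⟨⟨q, hq⟩⟩
  obtain ⟨g, hg⟩ := exists_surjective_nat {p // p ∉ K}
  refine ⟨fun k => g k.unpair.1, fun k => (g _).2, fun p hp k => ?_⟩
  obtain ⟨a, ha⟩ := hg ⟨p, hp⟩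
  exact ⟨Nat.pair a k, Nat.right_le_pair a k, by simp [ha]⟩

theorem map_upTo_succ (σ : ℕ → ℕ × P.St) (k : ℕ) :
    (P.upTo σ (k + 1)).map Prod.snd = (P.upTo σ k).map Prod.snd ++ [(σ k).2] := by
  simp [upTo, List.range_succ]

theorem mem_upTo {σ : ℕ → ℕ × P.St} {k : ℕ} {e : ℕ × P.St} :
    e ∈ P.upTo σ k ↔ ∃ i < k, σ i = e := by
  simp [upTo]

variable [DecidableEq Proc]

/-- Delivering messages with the least number first makes channels reliable: only finitely many
messages have a number that does not exceed a given one. -/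
theorem reliable_of_least_num [Finite Proc] {σ : ℕ → ℕ × P.St} {N : ℕ}
    (hσ : ∀ k, P.Conforms coord ((P.upTo σ k).map Prod.snd))
    (hleast : ∀ j ≥ N, ∀ o, (σ j).2.act = .recv o →
      ∀ m ∈ (P.final ((P.upTo σ j).map Prod.snd)).buff, m.dst = (σ j).2.proc →
        ∃ m', o = some m' ∧ m'.num ≤ m.num)
    {p : Proc} (hp : ∀ k, ∃ j ≥ k, (σ j).2.proc = p ∧ ∃ o, (σ j).2.act = .recv o)
    {i : ℕ} {m : Msg Proc P.Payload} (hm : (σ i).2.act = .send m) (hdst : m.dst = p) :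
    ∃ j, (σ j).2 = ⟨p, .recv (some m)⟩ := by
  by_contra! hnever
  have hmem : ∀ {j k : ℕ}, j < k → (σ j).2 ∈ (P.upTo σ k).map Prod.snd := fun {j k} h =>
    List.mem_map.2 ⟨σ j, mem_upTo.2 ⟨j, h, rfl⟩, rfl⟩
  have hbuff : ∀ j > i, m ∈ (P.final ((P.upTo σ j).map Prod.snd)).buff := by
    intro j hj
    refine ((hσ j).mem_buff m).2 ⟨⟨_, hmem hj, hm⟩, fun s hs he => ?_⟩
    have := (hσ j).proc_eq_dst hs he
    obtain ⟨e, he', rfl⟩ := List.mem_map.1 hs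
    obtain ⟨k, -, rfl⟩ := mem_upTo.1 he'
    refine hnever k ?_
    rw [← hdst, ← this, ← he]
  -- Each later attempt of `p` delivers a message whose number does not exceed that of `m`.
  let S : Set ℕ := {j | max N (i + 1) ≤ j ∧ (σ j).2.proc = p ∧ ∃ o, (σ j).2.act = .recv o}
  have hS : S.Infinite := by
    refine Set.infinite_of_not_bddAbove fun ⟨k, hk⟩ => ?_
    obtain ⟨j, hj, h⟩ := hp (max (max N (i + 1)) (k + 1))
    have := hk (show j ∈ S from ⟨(le_max_left ..).trans hj, h⟩)
    have := (le_max_right ..).trans hj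
    omega
  have hget : ∀ j, ∃ m', j ∈ S → (σ j).2.act = .recv (some m') ∧ m'.num ≤ m.num := by
    intro j
    by_cases hj : j ∈ S
    · obtain ⟨h1, h2, o, ho⟩ := hj
      obtain ⟨m', rfl, h⟩ := hleast j ((le_max_left ..).trans h1) o ho m
        (hbuff j ((le_max_right ..).trans h1)) (hdst.trans h2.symm)
      exact ⟨m', fun _ => ⟨ho, h⟩⟩
    · exact ⟨m, fun h => absurd h hj⟩
  choose g hg using hget
  -- There are only finitely many such messages, so one of them would be delivered twice.
  obtain ⟨j, hj, k, hk, hne, heq⟩ := hS.exists_ne_map_eq_of_mapsTo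
    (f := fun j => ((g j).src, (g j).num)) (t := Set.univ ×ˢ Set.Iic m.num)
    (fun j hj => ⟨trivial, (hg j hj).2⟩) (Set.finite_univ.prod (Set.finite_Iic _))
  wlog hlt : j < k generalizing j k
  · exact this k hk j hj hne.symm heq.symm (by omega)
  have hin : ∀ l ∈ S, g l ∈ (P.final ((P.upTo σ l).map Prod.snd)).buff := by
    intro l hl
    have h1 := hσ (l + 1)
    rw [map_upTo_succ] at h1
    have h2 := (conforms_concat.1 h1).2
    have h3 : (σ l).2 = ⟨(σ l).2.proc, .recv (some (g l))⟩ := by rw [← (hg l hl).1]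
    rw [h3] at h2
    exact (enabled_recv_iff.1 h2).2.1
  obtain ⟨s, hs, hs'⟩ := mem_buff_final (hin j hj)
  obtain ⟨⟨t, ht, ht'⟩, hno⟩ := ((hσ k).mem_buff _).1 (hin k hk)
  have hsub : s ∈ (P.upTo σ k).map Prod.snd := by
    obtain ⟨e, he, rfl⟩ := List.mem_map.1 hs
    obtain ⟨n, hn, rfl⟩ := mem_upTo.1 he
    exact hmem (hn.trans hlt)
  have h := (hσ k).msg_unique s hsub _ hs' t ht _ ht' (Prod.ext_iff.1 heq).1 (Prod.ext_iff.1 heq).2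
  exact hno _ (hmem hlt) (h ▸ (hg j hj).1)

/-- If a finite sequence of steps is possible without crashes, with the constant failure detector
history `calm`, then the processes of `K` may crash after it, and the others may go on forever. -/
theorem exists_infRun_extension [Fintype Proc] {K : Finset Proc}
    (hK : K.card < Fintype.card Proc) {l : List P.St} (hl : P.Conforms coord l) {calm : Proc → R}
    (hcalm : ∀ s ∈ l, ∀ v, s.act = .query v → v = calm s.proc) {T : ℕ} (hT : l.length ≤ T)
    {H : Proc → ℕ → R} (hH : ∀ t ≤ T, ∀ p, H p t = calm p) :
    ∃ σ, P.IsInfRun coord (FailurePattern.crashAfter T K) H σ ∧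
      P.upTo σ l.length = timed l ∧
      ∀ j ≥ l.length, T < (σ j).1 ∧ (σ j).2.proc ∉ K ∧ ∀ c, (σ j).2.act ≠ .submit c := by
  obtain ⟨π, hπK, hπ⟩ := exists_schedule hK
  choose next hen hsub hquery hleast using exists_step (P := P) coord
  let stp : ℕ → P.Conf → P.St := fun i C =>
    if h : i < l.length then l[i] else ⟨π i, next C (π i) (H (π i) (T + 1 + i))⟩
  let C : ℕ → P.Conf := fun k => Nat.rec P.startConf (fun i C => P.after C (stp i C)) k
  let σ : ℕ → ℕ × P.St := fun i => (if i < l.length then i else T + 1 + i, stp i (C i))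
  have hσ₁ : ∀ i (h : i < l.length), σ i = (i, l[i]) := fun i h => by simp [σ, stp, h]
  have hσ₂ : ∀ i ≥ l.length, σ i = (T + 1 + i, ⟨π i, next (C i) (π i) (H (π i) (T + 1 + i))⟩) :=
    fun i h => by simp [σ, stp, h.not_gt]
  have hfinal : ∀ k, P.final ((P.upTo σ k).map Prod.snd) = C k := by
    intro k
    induction k with
    | zero => rfl
    | succ k ih => rw [map_upTo_succ, final_concat, ih]
  have hupTo : P.upTo σ l.length = timed l := by
    apply List.ext_getElem
    · simp [upTo, timed]
    · intro i h1 h2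
      have : i < l.length := by simpa [upTo] using h1
      simp [upTo, timed, hσ₁ i this]
  have hconf : ∀ k, P.Conforms coord ((P.upTo σ k).map Prod.snd) := by
    intro k
    rcases le_total k l.length with hk | hk
    · have : (P.upTo σ l.length).map Prod.snd = l := by rw [hupTo, map_snd_timed]
      obtain ⟨d, hd⟩ := Nat.exists_eq_add_of_le hk
      rw [hd, upTo, List.range_add, List.map_append, List.map_append] at this
      exact Conforms.left (this ▸ hl)
    · induction k, hk using Nat.le_induction with
      | base => rwa [hupTo, map_snd_timed]
      | succ k hk ih =>
        rw [map_upTo_succ]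
        refine conforms_concat.2 ⟨ih, ?_⟩
        rw [hfinal, hσ₂ k hk]
        exact hen ..
  have hge : ∀ j ≥ l.length, T < (σ j).1 ∧ (σ j).2.proc ∉ K ∧ ∀ c, (σ j).2.act ≠ .submit c := by
    intro j hj
    rw [hσ₂ j hj]
    exact ⟨by simp only; omega, hπK j, hsub _ _ _⟩
  refine ⟨σ, ⟨fun k => ⟨?_, ?_, ?_, hconf k⟩, ?_, ?_⟩, hupTo, hge⟩
  · rw [upTo, List.map_map, List.pairwise_map]
    refine List.pairwise_lt_range.imp fun {i j} hij => ?_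
    simp only [Function.comp, σ]
    split_ifs <;> omega
  · intro e he
    obtain ⟨i, -, rfl⟩ := mem_upTo.1 he
    rcases lt_or_ge i l.length with h | h
    · rw [hσ₁ i h]
      exact fun h' => absurd h'.1 (by simp only; omega)
    · exact fun h' => (hge i h).2.1 h'.2
  · intro e he v hv
    obtain ⟨i, -, rfl⟩ := mem_upTo.1 he
    rcases lt_or_ge i l.length with h | h
    · rw [hσ₁ i h] at hv ⊢
      rw [hH i (h.le.trans hT)]
      exact hcalm _ (List.getElem_mem h) v hv
    · rw [hσ₂ i h] at hv ⊢
      exact hquery _ _ _ _ hv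
  · intro p hp k
    rw [FailurePattern.faulty_crashAfter] at hp
    obtain ⟨j, hj, rfl⟩ := hπ p (by simpa using hp) (max k l.length)
    have hj' := (le_max_right ..).trans hj
    refine ⟨j, (le_max_left ..).trans hj, ?_, (hge j hj').2.2⟩
    rw [hσ₂ j hj']
  · intro p hp i m hm hdst
    refine reliable_of_least_num hconf (N := l.length) ?_ hp hm hdst
    intro j hj o ho m hm hd
    rw [hfinal] at hm
    rw [hσ₂ j hj] at ho hd
    exact hleast _ _ _ _ ho m hm hd

end Extension

/-! ### Two fast decisions that cannot be told apart -/

section Split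

variable {Proc Cmd R : Type*} [DecidableEq Proc] {P : Protocol Proc Cmd R} {coord : Cmd → Proc}
  {calm : Proc → R} {conflict : SimpleGraph Cmd} {FD : FailureDetector Proc R}
  {E : Set (FailurePattern Proc)} {f : ℕ}

/-- The steps `Γ`, possible from the initial configuration when the failure detector returns `calm`,
end with a fast return of the announcement of `c`, without dependencies other than `c` itself; only
`c` is submitted, and every message sent is received. -/
structure IsSoloFastPath (P : Protocol Proc Cmd R) (coord : Cmd → Proc) (calm : Proc → R)
    (Γ : List P.St) (c : Cmd) : Prop where
  conforms : P.Conforms coord Γ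
  calm : ∀ s ∈ Γ, ∀ v, s.act = .query v → v = calm s.proc
  last : ∃ D ⊆ {c}, Γ.getLast? = some ⟨coord c, .respond c (some D) true⟩
  only : ∀ s ∈ Γ, ∀ d, s.act = .submit d → d = c
  received : ∀ s ∈ Γ, ∀ m, s.act = .send m → ∃ s' ∈ Γ, s'.act = .recv (some m)

/-- A part of `Γ₂` whose processes do not occur in `Γ₁` is possible after `Γ₁`. -/
theorem Conforms.combine {K : Finset Proc} {Γ₁ Γ₂ Δ₂ : List P.St} (h₁ : P.Conforms coord Γ₁)
    (h₂ : P.Conforms coord Γ₂) (hcut : IsCut K Γ₂ Δ₂)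
    (hdisj : ∀ s ∈ Γ₁, ∀ s' ∈ Δ₂, s.proc ≠ s'.proc) : P.Conforms coord (Γ₁ ++ Δ₂) := by
  refine conforms_of_local (h₁.deliveriesSent.append hcut.sent) fun p => ?_
  rw [stepsOf_append]
  by_cases hp : stepsOf p Γ₁ = []
  · rw [hp, List.nil_append]
    exact ⟨Γ₂, h₂, hcut.steps_prefix p⟩
  · obtain ⟨s, hs⟩ := List.exists_mem_of_ne_nil _ hp
    obtain ⟨hs₁, rfl⟩ := mem_stepsOf.1 hs
    have : stepsOf s.proc Δ₂ = [] := List.filter_eq_nil_iff.2 fun s' hs' => by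
      simpa using (hdisj s hs₁ s' hs').symm
    exact ⟨Γ₁, h₁, by rw [this, List.append_nil]⟩

theorem IsRun.of_prefix {A : FailurePattern Proc} {H : Proc → ℕ → R} {r r' : List (ℕ × P.St)}
    (h : P.IsRun coord A H r) (hr : r' <+: r) : P.IsRun coord A H r' := by
  obtain ⟨t, rfl⟩ := hr
  refine ⟨?_, fun e he => h.alive e (List.mem_append_left _ he),
    fun e he => h.detector e (List.mem_append_left _ he), ?_⟩
  · have := h.times
    rw [List.map_append] at this
    exact (List.pairwise_append.1 this).1
  · have := h.conforms
    rw [List.map_append] at this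
    exact Conforms.left this

section SMR

variable {A : FailurePattern Proc} {H : Proc → ℕ → R} {Γ : List P.St} {c : Cmd}
  {r : List (ℕ × P.St)}

theorem IsSoloFastPath.committed (hΓ : IsSoloFastPath P coord calm Γ c)
    (hP : P.IsLeaderlessSMR conflict coord FD E) (hA : A ∈ E) (hH : H ∈ FD.histories A)
    (hr : P.IsRun coord A H r) (hΓr : timed Γ <+: r) :
    ∃ D ⊆ {c}, P.depsAt Γ (coord c) c = .committed D := by
  obtain ⟨D, hD, hlast⟩ := hΓ.last
  have := hP.fastPath A hA H hH _ (hr.of_prefix hΓr) c D (by rwa [map_snd_timed])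
  rw [map_snd_timed] at this
  exact ⟨_, fun d hd => hD hd.1, this⟩

/-- After a fast path for `c`, no process can abort `c`. -/
theorem IsSoloFastPath.committed_of_decided (hΓ : IsSoloFastPath P coord calm Γ c)
    (hP : P.IsLeaderlessSMR conflict coord FD E) (hA : A ∈ E) (hH : H ∈ FD.histories A)
    (hr : P.IsRun coord A H r) (hΓr : timed Γ <+: r) {q : Proc}
    (hq : P.depsAt (r.map Prod.snd) q c ≠ .pending) :
    ∃ D, P.depsAt (r.map Prod.snd) q c = .committed D := by
  obtain ⟨D, -, hD⟩ := hΓ.committed hP hA hH hr hΓr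
  have := hP.agreement A hA H hH r hr _ hΓr r List.prefix_rfl (coord c) q c D
    (by rwa [map_snd_timed])
  cases h : P.depsAt (r.map Prod.snd) q c with
  | pending => exact absurd h hq
  | aborted => exact absurd h this
  | committed D' => exact ⟨D', rfl⟩

/-- After a fast path for `c`, wherever `c` is stable it has no dependency but itself. -/
theorem IsSoloFastPath.deps_of_stable (hΓ : IsSoloFastPath P coord calm Γ c)
    (hP : P.IsLeaderlessSMR conflict coord FD E) (hA : A ∈ E) (hH : H ∈ FD.histories A)
    (hr : P.IsRun coord A H r) (hΓr : timed Γ <+: r) {q : Proc} {D : Set Cmd}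
    (hst : Stable (P.depsAt (r.map Prod.snd) q) c)
    (hq : P.depsAt (r.map Prod.snd) q c = .committed D) : D ⊆ {c} := by
  obtain ⟨D₁, hD₁, hcom⟩ := hΓ.committed hP hA hH hr hΓr
  obtain ⟨D₂, hD₂⟩ := hP.stability A hA H hH r hr c
  have hst₁ : Stable (P.depsAt Γ (coord c)) c := by
    refine ⟨⟨D₁, hcom⟩, fun d hd => ?_⟩
    have : d = c := by
      induction hd with
      | refl => rfl
      | tail _ h ih =>
        obtain ⟨D', h1, h2⟩ := h
        rw [ih, hcom] at h1
        exact hD₁ (Dep.committed.inj h1 ▸ h2)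
    rw [this, hcom]
    simp
  have h1 := hD₂ _ hΓr (coord c) (by rwa [map_snd_timed])
  rw [map_snd_timed, hcom] at h1
  have h2 := hD₂ r List.prefix_rfl q hst
  rw [hq] at h2
  rwa [Dep.committed.inj h2, ← Dep.committed.inj h1]

end SMR

/-- Suppose that two conflicting commands can be announced alone on the fast path, by `Γ₁` and `Γ₂`,
and that `Γ₁` can be followed by a part of `Γ₂`, and `Γ₂` by a part of `Γ₁`, such that only `f`
processes `K` can tell the difference. If these crash, the others have to decide both commands
compatibly with both fast decisions, in which neither command depends on the other. -/
theorem false_of_cuts [Fintype Proc] (hf : f < Fintype.card Proc)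
    (hE : ∀ A : FailurePattern Proc, A.faulty.ncard ≤ f → A ∈ E)
    (hcalm : (fun p _ => calm p) ∈ FD.histories (FailurePattern.none Proc))
    (hP : P.IsLeaderlessSMR conflict coord FD E) (reliability : P.Reliability coord FD E f)
    {c₁ c₂ : Cmd} (hadj : conflict.Adj c₁ c₂) {K : Finset Proc} (hK : K.card ≤ f)
    {Γ₁ Γ₂ Δ₁ Δ₂ : List P.St} (h₁ : IsSoloFastPath P coord calm Γ₁ c₁)
    (h₂ : IsSoloFastPath P coord calm Γ₂ c₂) (cut₁ : IsCut K Γ₁ Δ₁) (cut₂ : IsCut K Γ₂ Δ₂)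
    (hs₁ : ⟨coord c₁, .submit c₁⟩ ∈ Δ₁) (hs₂ : ⟨coord c₂, .submit c₂⟩ ∈ Δ₂)
    (hd₁ : ∀ s ∈ Γ₁, ∀ s' ∈ Δ₂, s.proc ≠ s'.proc)
    (hd₂ : ∀ s ∈ Γ₂, ∀ s' ∈ Δ₁, s.proc ≠ s'.proc) : False := by
  have hl₁ := h₁.conforms.combine h₂.conforms cut₂ hd₁
  have hl₂ := h₂.conforms.combine h₁.conforms cut₁ hd₂
  have hcalm₁ : ∀ s ∈ Γ₁ ++ Δ₂, ∀ v, s.act = .query v → v = calm s.proc := fun s hs =>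
    (List.mem_append.1 hs).elim (h₁.calm s) fun h => h₂.calm s (cut₂.subset h)
  have hcalm₂ : ∀ s ∈ Γ₂ ++ Δ₁, ∀ v, s.act = .query v → v = calm s.proc := fun s hs =>
    (List.mem_append.1 hs).elim (h₂.calm s) fun h => h₁.calm s (cut₁.subset h)
  have hloc : ∀ p ∉ K, stepsOf p (Γ₁ ++ Δ₂) = stepsOf p (Γ₂ ++ Δ₁) := by
    intro p hp
    rw [stepsOf_append, stepsOf_append, cut₁.steps_eq p hp, cut₂.steps_eq p hp]
    by_cases h : stepsOf p Γ₁ = []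
    · simp [h]
    · obtain ⟨s, hs⟩ := List.exists_mem_of_ne_nil _ h
      obtain ⟨hs', rfl⟩ := mem_stepsOf.1 hs
      have : stepsOf s.proc Γ₂ = [] := by
        rw [← cut₂.steps_eq _ hp]
        exact List.filter_eq_nil_iff.2 fun t ht => by simpa using (hd₁ s hs' t ht).symm
      simp [this]
  have hrecv : ∀ s ∈ Γ₁ ++ Δ₂, ∀ m, s.act = .send m → m.dst ∉ K →
      ∃ s' ∈ Γ₁ ++ Δ₂, s'.act = .recv (some m) := by
    intro s hs m hm hdst
    rcases List.mem_append.1 hs with hs | hs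
    · obtain ⟨s', h, h'⟩ := h₁.received s hs m hm
      exact ⟨s', List.mem_append_left _ h, h'⟩
    · obtain ⟨s', h, h'⟩ := h₂.received s (cut₂.subset hs) m hm
      have h3 : s' ∈ stepsOf m.dst Γ₂ := mem_stepsOf.2 ⟨h, h₂.conforms.proc_eq_dst h h'⟩
      rw [← cut₂.steps_eq _ hdst] at h3
      exact ⟨s', List.mem_append_right _ (mem_stepsOf.1 h3).1, h'⟩
  -- The failure detector cannot forecast the crash of `K`, which happens after time `T`.
  set T := max (Γ₁ ++ Δ₂).length (Γ₂ ++ Δ₁).length with hT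
  set A := FailurePattern.crashAfter T K with hA
  have hfaulty : A.faulty = K := FailurePattern.faulty_crashAfter T K
  have hcard : A.faulty.ncard ≤ f := by rwa [hfaulty, Set.ncard_coe_finset]
  have hAE := hE A hcard
  obtain ⟨H, hH, hHcalm⟩ := FD.realistic (FailurePattern.none Proc) A T (fun s hs => by
    ext p; simp [FailurePattern.none, hA, FailurePattern.crashAfter, hs.not_gt]) _ hcalm
  obtain ⟨σ, hσ, hσl, hσρ⟩ := exists_infRun_extension (hK.trans_lt hf) hl₁ hcalm₁
    (T := T) (le_max_left ..) (H := H) fun t ht p => (hHcalm t ht p).symm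
  obtain ⟨q, -, hq⟩ := Finset.exists_mem_notMem_of_card_lt_card (s := K) (t := Finset.univ)
    (hK.trans_lt hf)
  set n := (Γ₁ ++ Δ₂).length with hn
  have hsplit : ∀ d, P.upTo σ (n + d) =
      timed (Γ₁ ++ Δ₂) ++ (List.range d).map fun i => σ (n + i) := by
    intro d
    rw [← hσl, upTo, List.range_add, List.map_append, List.map_map]
    rfl
  -- Both commands are eventually decided at the correct process `q`.
  have hdec : ∀ c, ⟨coord c, .submit c⟩ ∈ Γ₁ ++ Δ₂ →
      ∃ k, ∀ k' ≥ k, P.depsAt ((P.upTo σ k').map Prod.snd) q c ≠ .pending := by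
    intro c hc
    obtain ⟨i, hi⟩ : ∃ i, (σ i).2.act = .submit c := by
      rw [← map_snd_timed (Γ₁ ++ Δ₂), ← hσl] at hc
      obtain ⟨e, he, he'⟩ := List.mem_map.1 hc
      obtain ⟨i, -, rfl⟩ := mem_upTo.1 he
      exact ⟨i, by rw [he']⟩
    obtain ⟨k, hk⟩ := reliability A hAE H hH σ hσ hcard c ⟨i, hi⟩ q (by simpa [hfaulty] using hq)
    refine ⟨k, fun k' hk' => ?_⟩
    refine hP.decided_once A hAE H hH _ (hσ.isRun k') (P.upTo σ k) ?_ q c hk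
    obtain ⟨d, rfl⟩ := Nat.exists_eq_add_of_le hk'
    rw [upTo, upTo, List.range_add, List.map_append]
    exact List.prefix_append ..
  obtain ⟨k₁, hk₁⟩ := hdec c₁ (List.mem_append_left _ (cut₁.subset hs₁))
  obtain ⟨k₂, hk₂⟩ := hdec c₂ (List.mem_append_right _ hs₂)
  set d := max k₁ k₂
  set ρ := (List.range d).map fun i => σ (n + i) with hρ
  have hr₁ := hσ.isRun (n + d)
  specialize hk₁ (n + d) ((le_max_left ..).trans (Nat.le_add_left ..))
  specialize hk₂ (n + d) ((le_max_right ..).trans (Nat.le_add_left ..))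
  rw [hsplit, ← hρ] at hr₁ hk₁ hk₂
  have hρmem : ∀ e ∈ ρ, T < e.1 ∧ e.2.proc ∉ K ∧ ∀ c, e.2.act ≠ .submit c := by
    intro e he
    obtain ⟨i, -, rfl⟩ := List.mem_map.1 he
    exact hσρ _ (Nat.le_add_right ..)
  have hsnd₁ : (timed (Γ₁ ++ Δ₂) ++ ρ).map Prod.snd = Γ₁ ++ Δ₂ ++ ρ.map Prod.snd := by
    rw [List.map_append, map_snd_timed]
  have hsnd₂ : (timed (Γ₂ ++ Δ₁) ++ ρ).map Prod.snd = Γ₂ ++ Δ₁ ++ ρ.map Prod.snd := by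
    rw [List.map_append, map_snd_timed]
  have hr₂ : P.IsRun coord A H (timed (Γ₂ ++ Δ₁) ++ ρ) := by
    refine ⟨?_, fun e he => ?_, fun e he v hv => ?_, ?_⟩
    · have := hr₁.times
      rw [List.map_append, map_fst_timed] at this ⊢
      refine List.pairwise_append.2 ⟨List.pairwise_lt_range, (List.pairwise_append.1 this).2.1, ?_⟩
      intro i hi j hj
      obtain ⟨e, he, rfl⟩ := List.mem_map.1 hj
      exact ((List.mem_range.1 hi).trans_le (le_max_right ..)).trans (hρmem e he).1
    · rcases List.mem_append.1 he with h | h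
      · exact fun h' => h'.1.not_ge ((mem_timed h).1.le.trans (le_max_right ..))
      · exact hr₁.alive e (List.mem_append_right _ h)
    · rcases List.mem_append.1 he with h | h
      · rw [← hHcalm e.1 ((mem_timed h).1.le.trans (le_max_right ..))]
        exact hcalm₂ _ (mem_timed h).2 v hv
      · exact hr₁.detector e (List.mem_append_right _ h) v hv
    · rw [hsnd₂]
      refine conforms_append_of_indistinguishable (K := K) (hsnd₁ ▸ hr₁.conforms) hl₂ ?_ hloc hrecv
      intro s hs
      obtain ⟨e, he, rfl⟩ := List.mem_map.1 hs
      exact (hρmem e he).2.1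
  have hdeps : P.depsAt ((timed (Γ₁ ++ Δ₂) ++ ρ).map Prod.snd) q =
      P.depsAt ((timed (Γ₂ ++ Δ₁) ++ ρ).map Prod.snd) q := by
    rw [hsnd₁, hsnd₂]
    ext c
    unfold depsAt
    rw [state_final_congr (l' := Γ₂ ++ Δ₁ ++ ρ.map Prod.snd)]
    rw [stepsOf_append _ _ (ρ.map Prod.snd), stepsOf_append _ _ (ρ.map Prod.snd), hloc q hq]
  have hpre₁ : timed Γ₁ <+: timed (Γ₁ ++ Δ₂) ++ ρ :=
    (timed_prefix ..).trans (List.prefix_append ..)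
  have hpre₂ : timed Γ₂ <+: timed (Γ₂ ++ Δ₁) ++ ρ :=
    (timed_prefix ..).trans (List.prefix_append ..)
  obtain ⟨D₁, hD₁⟩ := h₁.committed_of_decided hP hAE hH hr₁ hpre₁ hk₁
  obtain ⟨D₂, hD₂⟩ := h₂.committed_of_decided hP hAE hH hr₂ hpre₂ (hdeps ▸ hk₂)
  -- Only the two commands are submitted, so both are stable at `q`.
  have hsub : (P.final ((timed (Γ₁ ++ Δ₂) ++ ρ).map Prod.snd)).submitted ⊆ {c₁, c₂} := by
    intro c hc
    rw [hsnd₁] at hc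
    obtain ⟨s, hs, hs'⟩ := mem_submitted_final.1 hc
    rcases List.mem_append.1 hs with hs | hs
    · rcases List.mem_append.1 hs with hs | hs
      · exact .inl (h₁.only s hs c hs')
      · exact .inr (h₂.only s (cut₂.subset hs) c hs')
    · obtain ⟨e, he, rfl⟩ := List.mem_map.1 hs
      exact absurd hs' ((hρmem e he).2.2 c)
  have hclosed : ∀ c ∈ ({c₁, c₂} : Set Cmd), ∀ d,
      InClosure (P.depsAt ((timed (Γ₁ ++ Δ₂) ++ ρ).map Prod.snd) q) c d →
      d ∈ ({c₁, c₂} : Set Cmd) := by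
    intro c hc d hd
    induction hd with
    | refl => exact hc
    | tail _ h _ =>
      obtain ⟨D, h3, h4⟩ := h
      exact hsub ((hP.validity A hAE H hH _ hr₁ q _ D h3).2 h4)
  have hnp : ∀ c ∈ ({c₁, c₂} : Set Cmd),
      P.depsAt ((timed (Γ₁ ++ Δ₂) ++ ρ).map Prod.snd) q c ≠ .pending := by
    rintro c (rfl | rfl)
    exacts [hk₁, hk₂]
  have hst₁ : Stable (P.depsAt ((timed (Γ₁ ++ Δ₂) ++ ρ).map Prod.snd) q) c₁ :=
    ⟨⟨D₁, hD₁⟩, fun d hd => hnp d (hclosed c₁ (.inl rfl) d hd)⟩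
  have hst₂ : Stable (P.depsAt ((timed (Γ₂ ++ Δ₁) ++ ρ).map Prod.snd) q) c₂ :=
    ⟨⟨D₂, hD₂⟩, fun d hd => hdeps ▸ hnp d (hclosed c₂ (.inr rfl) d (hdeps ▸ hd))⟩
  have hsub₁ := h₁.deps_of_stable hP hAE hH hr₁ hpre₁ hst₁ hD₁
  have hsub₂ := h₂.deps_of_stable hP hAE hH hr₂ hpre₂ hst₂ hD₂
  rcases hP.consistency A hAE H hH _ hr₁ q c₁ c₂ D₁ D₂ hadj hD₁ (hdeps ▸ hD₂) with h | h
  · exact hadj.ne (hsub₂ h)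
  · exact hadj.ne (hsub₁ h).symm

/-! ### Fast path quorums -/

/-- Started from the initial configuration, an announcement that uses exactly the quorum `Q` takes
the fast path, in two message delays. -/
theorem exists_soloFastPath [Fintype Proc] {F : ℕ}
    (latency : P.OptimalLatency conflict coord calm) (balancing : P.LoadBalancing coord calm F)
    {c : Cmd} {Q : Finset Proc} (hQ : IsFastQuorum coord F c Q) :
    ∃ Γ : List P.St, IsSoloFastPath P coord calm Γ c ∧ IsAnnouncement coord Γ c ∧
      (∀ k, CausalPath Γ 0 (Γ.length - 1) k → k ≤ 2) ∧ ∀ p, p ∈ Q ↔ ∃ s ∈ Γ, s.proc = p := by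
  have hrest : P.AtRest [] := ⟨rfl, by simp [startConf], by simp⟩
  have hnice : P.Nice coord calm [] := ⟨[], ⟨by simp, by simp, by simp, trivial⟩, rfl⟩
  obtain ⟨Γ, hΓ, hann, hproc, hrecv⟩ := balancing [] hnice hrest c (by simp [startConf]) Q hQ
  rw [List.nil_append] at hΓ
  have hconf : P.Conforms coord Γ := by
    obtain ⟨r, hr, rfl⟩ := hΓ
    exact hr.conforms
  obtain ⟨D, flag, hlast⟩ := hann.last
  have hfirst := hann.first
  have hlt : 0 < Γ.length - 1 := by
    by_contra h
    rw [Nat.eq_zero_of_not_pos h, hfirst] at hlast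
    simp at hlast
  have honly : ∀ i d, Γ[i]? = some (⟨coord d, .submit d⟩ : P.St) → d = c := fun i d h =>
    hann.only _ (List.mem_of_getElem? h) d rfl
  -- A command is not submitted twice.
  have honce : ∀ i > 0, ∀ d, Γ[i]? ≠ some (⟨coord d, .submit d⟩ : P.St) := by
    intro i hi d hd
    obtain rfl := honly i d hd
    obtain ⟨hi', hd'⟩ := List.getElem?_eq_some_iff.1 hd
    have hΓ' : Γ = Γ.take i ++ ⟨coord d, .submit d⟩ :: Γ.drop (i + 1) := by
      rw [← hd', ← List.drop_eq_getElem_cons hi', List.take_append_drop]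
    rw [hΓ'] at hconf
    refine (enabled_submit_iff.1 hconf.enabled).2
      (mem_submitted_final.2 ⟨⟨coord d, .submit d⟩, ?_, rfl⟩)
    exact List.mem_of_getElem? (i := 0) (by rw [List.getElem?_take_of_lt hi, hfirst])
  obtain ⟨⟨D, rfl, hD⟩, hflag, hdelay⟩ := latency Γ hΓ c _ flag 0 _ hlt hfirst hlast
  have htwo := hdelay (by simpa using hrest) fun i d hi _ => honce i hi d
  obtain rfl : flag = true := hflag.resolve_right fun ⟨d, hadj, ⟨i, _, hi⟩, _⟩ =>
    hadj.ne (honly i d hi).symm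
  refine ⟨Γ, ⟨hconf, ?_, ⟨D, ?_, ?_⟩, hann.only, hrecv⟩, hann, fun k hk => htwo.2 hk, hproc⟩
  · obtain ⟨r, hr, rfl⟩ := hΓ
    intro s hs v hv
    obtain ⟨e, he, rfl⟩ := List.mem_map.1 hs
    exact hr.detector e he v hv
  · intro d hd
    obtain ⟨i, -, hi, -⟩ := hD d hd
    exact honly i d hi
  · rw [List.getLast?_eq_getElem?, hlast]

/-- Two sets of `m` elements in a set of `N` elements, which overlap as little as possible. -/
theorem exists_subsets_small_inter {α : Type*} [DecidableEq α] (V : Finset α) {m : ℕ}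
    (hm : m ≤ V.card) :
    ∃ X ⊆ V, ∃ Y ⊆ V, X.card = m ∧ Y.card = m ∧ (X ∩ Y).card = 2 * m - V.card := by
  obtain ⟨X, hX, hXm⟩ := Finset.exists_subset_card_eq hm
  have hsd : (V \ X).card = V.card - m := by rw [Finset.card_sdiff_of_subset hX, hXm]
  rcases le_total m (V.card - m) with h | h
  · obtain ⟨Y, hY, hYm⟩ := Finset.exists_subset_card_eq (hsd ▸ h)
    refine ⟨X, hX, Y, hY.trans Finset.sdiff_subset, hXm, hYm, ?_⟩
    have : Disjoint X Y := Finset.disjoint_of_subset_right hY Finset.disjoint_sdiff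
    rw [Finset.disjoint_iff_inter_eq_empty.1 this, Finset.card_empty]
    omega
  · obtain ⟨Y, hY, hYV, hYm⟩ := Finset.exists_subsuperset_card_eq
      (Finset.sdiff_subset : V \ X ⊆ V) (hsd ▸ h) hm
    refine ⟨X, hX, Y, hYV, hXm, hYm, ?_⟩
    have hunion : X ∪ Y = V := by
      refine (Finset.union_subset hX hYV).antisymm fun a ha => ?_
      by_cases haX : a ∈ X
      · exact Finset.mem_union_left _ haX
      · exact Finset.mem_union_right _ (hY (Finset.mem_sdiff.2 ⟨ha, haX⟩))
    have := Finset.card_union_add_card_inter X Y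
    rw [hunion] at this
    omega

end Split

end Protocol

end Roll

/-! ### The bound -/

open Roll Roll.Protocol in
theorem mainTheorem1 {Proc Cmd R : Type*} [Fintype Proc] [DecidableEq Proc]
    (conflict : SimpleGraph Cmd) (coord : Cmd → Proc)
    (FD : Roll.FailureDetector Proc R) (E : Set (Roll.FailurePattern Proc)) (calm : Proc → R)
    (F f : ℕ) (hf : f < Fintype.card Proc)
    (hE : ∀ A : Roll.FailurePattern Proc, A.faulty.ncard ≤ f → A ∈ E)
    (hcalm : (fun p _ => calm p) ∈ FD.histories (Roll.FailurePattern.none Proc))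
    (hconf : ∃ c d, conflict.Adj c d ∧ coord c ≠ coord d)
    (P : Roll.Protocol Proc Cmd R)
    (hP : P.IsLeaderlessSMR conflict coord FD E)
    (reliability : P.Reliability coord FD E f)
    (latency : P.OptimalLatency conflict coord calm)
    (balancing : P.LoadBalancing coord calm F) :
    2 * (F : ℤ) + f - 1 ≤ Fintype.card Proc := by
  by_contra! hbound
  obtain ⟨c₁, c₂, hadj, hne⟩ := hconf
  set N := Fintype.card Proc with hN
  have hF : 1 ≤ F := by omega
  -- Two fast path quorums, each without the coordinator of the other command.
  set V : Finset Proc := Finset.univ \ {coord c₁, coord c₂} with hV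
  have hVcard : V.card = N - 2 := by
    rw [hV, Finset.card_sdiff_of_subset (Finset.subset_univ _), Finset.card_pair hne,
      Finset.card_univ]
  have h2 : 2 ≤ N := by
    rw [hN, ← Finset.card_pair hne]
    exact Finset.card_le_univ _
  obtain ⟨X₁, hX₁, X₂, hX₂, hc₁, hc₂, hinter⟩ :=
    exists_subsets_small_inter V (m := N - 1 - F) (by omega)
  have hV₁ : coord c₁ ∉ V := by simp [hV]
  have hV₂ : coord c₂ ∉ V := by simp [hV]
  have hQ₁ : IsFastQuorum coord F c₁ (insert (coord c₁) X₁) := by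
    refine ⟨Finset.mem_insert_self .., ?_⟩
    rw [Finset.card_insert_of_notMem fun h => hV₁ (hX₁ h)]
    omega
  have hQ₂ : IsFastQuorum coord F c₂ (insert (coord c₂) X₂) := by
    refine ⟨Finset.mem_insert_self .., ?_⟩
    rw [Finset.card_insert_of_notMem fun h => hV₂ (hX₂ h)]
    omega
  obtain ⟨Γ₁, h₁, ha₁, hlat₁, hp₁⟩ := exists_soloFastPath latency balancing hQ₁
  obtain ⟨Γ₂, h₂, ha₂, hlat₂, hp₂⟩ := exists_soloFastPath latency balancing hQ₂
  have hproc₁ : ∀ s ∈ Γ₁, s.proc = coord c₁ ∨ s.proc ∈ X₁ := fun s hs =>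
    Finset.mem_insert.1 ((hp₁ _).2 ⟨s, hs, rfl⟩)
  have hproc₂ : ∀ s ∈ Γ₂, s.proc = coord c₂ ∨ s.proc ∈ X₂ := fun s hs =>
    Finset.mem_insert.1 ((hp₂ _).2 ⟨s, hs, rfl⟩)
  rcases Finset.eq_empty_or_nonempty (X₁ ∩ X₂) with hemp | hemp
  · -- With disjoint quorums, the two announcements do not interfere, and no crash is needed.
    have hdisj : ∀ s ∈ Γ₁, ∀ s' ∈ Γ₂, s.proc ≠ s'.proc := by
      intro s hs s' hs' e
      rcases hproc₁ s hs with h | h <;> rcases hproc₂ s' hs' with h' | h'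
      · exact hne (by rw [← h, ← h', e])
      · exact hV₁ (hX₂ (by rwa [← h, e]))
      · exact hV₂ (hX₁ (by rwa [← h', ← e]))
      · exact Finset.notMem_empty _ (hemp ▸ Finset.mem_inter.2 ⟨h, e ▸ h'⟩)
    exact false_of_cuts hf hE hcalm hP reliability hadj (K := ∅) (by simp) h₁ h₂
      (.refl h₁.conforms _) (.refl h₂.conforms _) (List.mem_of_getElem? ha₁.first)
      (List.mem_of_getElem? ha₂.first) hdisj fun s hs s' hs' => (hdisj s' hs' s hs).symm
  · -- Otherwise the intersection of the quorums crashes, and so do the two coordinators.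
    set K := X₁ ∩ X₂ ∪ {coord c₁, coord c₂} with hKdef
    have hK : K.card ≤ f := by
      have h3 : K.card ≤ _ := Finset.card_union_le (X₁ ∩ X₂) {coord c₁, coord c₂}
      have h4 := Finset.card_pos.2 hemp
      rw [Finset.card_pair hne] at h3
      omega
    obtain ⟨Δ₁, cut₁, hs₁, hΔ₁⟩ := ha₁.exists_isCut h₁.conforms hlat₁ (X₁ \ X₂) K
      (fun h => hV₁ (hX₁ (Finset.mem_sdiff.1 h).1)) (by simp [hKdef]) fun s hs hsK => by
        have := hproc₁ s hs
        simp [hKdef] at hsK ⊢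
        tauto
    obtain ⟨Δ₂, cut₂, hs₂, hΔ₂⟩ := ha₂.exists_isCut h₂.conforms hlat₂ (X₂ \ X₁) K
      (fun h => hV₂ (hX₂ (Finset.mem_sdiff.1 h).1)) (by simp [hKdef]) fun s hs hsK => by
        have := hproc₂ s hs
        simp [hKdef] at hsK ⊢
        tauto
    refine false_of_cuts hf hE hcalm hP reliability hadj hK h₁ h₂ cut₁ cut₂ hs₁ hs₂ ?_ ?_
    · intro s hs s' hs' e
      rcases hproc₁ s hs with h | h <;> rcases hΔ₂ s' hs' with h' | h'
      · exact hne (by rw [← h, ← h', e])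
      · exact hV₁ (hX₂ (by rw [← h, e]; exact (Finset.mem_sdiff.1 h').1))
      · exact hV₂ (hX₁ (by rwa [← h', ← e]))
      · exact (Finset.mem_sdiff.1 h').2 (e ▸ h)
    · intro s hs s' hs' e
      rcases hproc₂ s hs with h | h <;> rcases hΔ₁ s' hs' with h' | h'
      · exact hne (by rw [← h, ← h', e])
      · exact hV₂ (hX₁ (by rw [← h, e]; exact (Finset.mem_sdiff.1 h').1))
      · exact hV₁ (hX₂ (by rwa [← h', ← e]))
      · exact (Finset.mem_sdiff.1 h').2 (e ▸ h)
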